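/- Let $M$ be a finite-dimensional smooth Riemannian manifold, possibly with boundary, let $X$ be a $C^1$ vector field on $M$ generating a flow $X_t$ (defined for all $t\ge 0$, with $X_{-t}$ the inverse of $X_t$), and let $\Gamma\subset M$ be a compact invariant set, $X_t(\Gamma)=\Gamma$ for all $t\in\mathbb R$. Let $T_\Gamma M=E\oplus F$ be a continuous $DX_t$-invariant splitting with $\dim F_x=k\ge 1$ for all $x\in\Gamma$. Give $\wedge^kTM$ the norm induced by the metric, via $\langle u_1\wedge\dots\wedge u_k,v_1\wedge\dots\wedge v_k\rangle=\det(\langle u_i,v_j\rangle)$. Let $\widetilde F=\wedge^kF$, and let $\widetilde E$ be the span of the products $v_1\wedge\dots\wedge v_k$ in which each $v_i$ lies in $E$ or in $F$ and at least one $v_i$ lies in $E$; thus $\wedge^kT_\Gamma M=\widetilde E\oplus\widetilde F$. For $A_t=DX_t$ or $A_t=\wedge^kDX_t$, a splitting $G=E'\oplus F'$ of the corresponding bundle over $\Gamma$ is called *dominated* if it is continuous and $A_t$-invariant, $E'_x\ne 0\ne F'_x$, and there are $K,\lambda>0$ with $\|A_t|_{E'_x}\|\cdot\|A_{-t}|_{F'_{X_t(x)}}\|<Ke^{-\lambda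 t}$ for all $x\in\Gamma$, $t>0$. The subbundle $E'$ is *uniformly contracted* if $\|A_t|_{E'_x}\|\le Ce^{-\lambda t}$, and $F'$ is *uniformly expanded* if $\|(A_t|_{F'_x})^{-1}\|\le Ce^{-\lambda t}$, for some $C,\lambda>0$ and all $x\in\Gamma$, $t\ge0$. The splitting is *partially hyperbolic* if it is dominated and $E'$ is uniformly contracted or $F'$ is uniformly expanded. The subbundle $F$ is *volume expanding* if $|\det(DX_t|_{F_x})|>Ce^{\lambda t}$ for some $C,\lambda>0$ and all $x\in\Gamma$, $t>0$. Finally, $E\oplus F$ is *singular hyperbolic* if it is dominated, $E$ is uniformly contracted and $F$ is volume expanding. Then: (1) $F$ is volume expanding under $DX_t$ if and only if the line bundle $\widetilde F=\wedge^kF$ is uniformly expanded by $\wedge^kDX_t$. (2) If $E$ is uniformly contracted by $DX_t$, then $E\oplus F$ is a singular hyperbolic splitting for $DX_t$ if and only if $\widetilde E\oplus\widetilde F$ is a partially hyperbolic splitting for $\wedge^kDX_t$ with $\widetilde F$ uniformly expanded by $\wedge^kDX_t$. -/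

import Mathlib

open Set Manifold Bundle Topology ContDiff

noncomputable section

/-! ### Linear algebra -/

/-- The operator norm of the restriction of `A` to the subspace `S`. -/
def restrictNorm {V W : Type*} [NormedAddCommGroup V] [NormedSpace ℝ V] [FiniteDimensional ℝ V]
    [NormedAddCommGroup W] [NormedSpace ℝ W] (A : V →ₗ[ℝ] W) (S : Submodule ℝ V) : ℝ :=
  ‖LinearMap.toContinuousLinearMap (A ∘ₗ S.subtype)‖

/-- `|det (A|S)|`: the volume of the parallelepiped spanned by the images under `A` of the vectors
of an orthonormal basis of `S`. -/
def absDetOn {V W : Type*} [NormedAddCommGroup V] [InnerProductSpace ℝ V] [FiniteDimensional ℝ V]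
    [NormedAddCommGroup W] [InnerProductSpace ℝ W] (A : V →ₗ[ℝ] W) (S : Submodule ℝ V) : ℝ :=
  Real.sqrt (Matrix.gram ℝ (fun i => A (stdOrthonormalBasis ℝ S i : V))).det

/-- The subspace `⋀^k F` of `⋀^k V`, spanned by the `f₁ ∧ ⋯ ∧ f_k` with all `f_i ∈ F`. -/
def wedgeSub {V : Type*} [AddCommGroup V] [Module ℝ V] (k : ℕ) (F : Submodule ℝ V) :
    Submodule ℝ (⋀[ℝ]^k V) :=
  Submodule.span ℝ {w | ∃ v : Fin k → V, (∀ i, v i ∈ F) ∧ w = exteriorPower.ιMulti ℝ k v}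

/-- The subspace of `⋀^k V` spanned by the exterior products of vectors of `E` and of `F`, with at
least one factor in `E`. -/
def mixedSub {V : Type*} [AddCommGroup V] [Module ℝ V] (k : ℕ) (E F : Submodule ℝ V) :
    Submodule ℝ (⋀[ℝ]^k V) :=
  Submodule.span ℝ {w | ∃ v : Fin k → V, (∀ i, v i ∈ E ∨ v i ∈ F) ∧ (∃ i, v i ∈ E) ∧
    w = exteriorPower.ιMulti ℝ k v}

/-! ### Linear cocycles over a flow

`φ` is the flow on the base `M`, `G` is a vector bundle over `M`, and
`A t x : G x → G (φ t x)` is the cocycle. The predicate `IsCont W s` says that `s` is a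
continuous section of `G` over the subset `W` of `M`. -/

/-- The family of subspaces `S x` of `G x`, `x ∈ Γ`, is a continuous subbundle over `Γ`: locally it
is spanned by a frame of continuous sections. -/
def IsContSubbundle {M : Type*} [TopologicalSpace M] {G : M → Type*}
    [∀ x, AddCommGroup (G x)] [∀ x, Module ℝ (G x)]
    (IsCont : Set M → (∀ x, G x) → Prop) (Γ : Set M) (S : ∀ x, Submodule ℝ (G x)) : Prop :=
  ∀ x₀ ∈ Γ, ∃ U ∈ 𝓝 x₀, ∃ (d : ℕ) (s : Fin d → ∀ x, G x),
    (∀ i, IsCont (U ∩ Γ) (s i)) ∧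
    ∀ x ∈ U ∩ Γ, LinearIndependent ℝ (fun i => s i x) ∧
      Submodule.span ℝ (range fun i => s i x) = S x

/-- `E ⊕ F` is a continuous `A`-invariant splitting of the bundle `G` over `Γ`. -/
structure IsInvariantSplitting {M : Type*} [TopologicalSpace M] {G : M → Type*}
    [∀ x, AddCommGroup (G x)] [∀ x, Module ℝ (G x)]
    (IsCont : Set M → (∀ x, G x) → Prop) (φ : ℝ → M → M)
    (A : ∀ (t : ℝ) (x : M), G x →ₗ[ℝ] G (φ t x)) (Γ : Set M)
    (E F : ∀ x, Submodule ℝ (G x)) : Prop where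
  isCompl : ∀ x ∈ Γ, IsCompl (E x) (F x)
  continuous_left : IsContSubbundle IsCont Γ E
  continuous_right : IsContSubbundle IsCont Γ F
  map_left : ∀ x ∈ Γ, ∀ t : ℝ, (E x).map (A t x) = E (φ t x)
  map_right : ∀ x ∈ Γ, ∀ t : ℝ, (F x).map (A t x) = F (φ t x)

section Cocycle

variable {M : Type*} {G : M → Type*}
  [∀ x, NormedAddCommGroup (G x)] [∀ x, InnerProductSpace ℝ (G x)]
  [∀ x, FiniteDimensional ℝ (G x)]

/-- `E ⊕ F` is a dominated splitting over `Γ` for the cocycle `A`. -/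
structure IsDominatedSplitting [TopologicalSpace M]
    (IsCont : Set M → (∀ x, G x) → Prop) (φ : ℝ → M → M)
    (A : ∀ (t : ℝ) (x : M), G x →ₗ[ℝ] G (φ t x)) (Γ : Set M)
    (E F : ∀ x, Submodule ℝ (G x)) : Prop extends
    IsInvariantSplitting IsCont φ A Γ E F where
  left_ne_bot : ∀ x ∈ Γ, E x ≠ ⊥
  right_ne_bot : ∀ x ∈ Γ, F x ≠ ⊥
  dominated : ∃ K > 0, ∃ lam > 0, ∀ x ∈ Γ, ∀ t : ℝ, 0 < t →
    restrictNorm (A t x) (E x) * restrictNorm (A (-t) (φ t x)) (F (φ t x))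
      < K * Real.exp (-lam * t)

/-- `E` is uniformly contracted by `A`. -/
def UniformlyContracted (φ : ℝ → M → M)
    (A : ∀ (t : ℝ) (x : M), G x →ₗ[ℝ] G (φ t x)) (Γ : Set M)
    (E : ∀ x, Submodule ℝ (G x)) : Prop :=
  ∃ C > 0, ∃ lam > 0, ∀ x ∈ Γ, ∀ t : ℝ, 0 ≤ t →
    restrictNorm (A t x) (E x) ≤ C * Real.exp (-lam * t)

/-- `F` is uniformly expanded by `A`: the inverse `A (-t) (φ t x)` of `A t x`, restricted
to `F (φ t x)`, has norm at most `C * exp (-lam * t)`. -/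
def UniformlyExpanded (φ : ℝ → M → M)
    (A : ∀ (t : ℝ) (x : M), G x →ₗ[ℝ] G (φ t x)) (Γ : Set M)
    (F : ∀ x, Submodule ℝ (G x)) : Prop :=
  ∃ C > 0, ∃ lam > 0, ∀ x ∈ Γ, ∀ t : ℝ, 0 ≤ t →
    restrictNorm (A (-t) (φ t x)) (F (φ t x)) ≤ C * Real.exp (-lam * t)

/-- `F` is volume expanding under `A`. -/
def VolumeExpanding (φ : ℝ → M → M)
    (A : ∀ (t : ℝ) (x : M), G x →ₗ[ℝ] G (φ t x)) (Γ : Set M)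
    (F : ∀ x, Submodule ℝ (G x)) : Prop :=
  ∃ C > 0, ∃ lam > 0, ∀ x ∈ Γ, ∀ t : ℝ, 0 < t →
    C * Real.exp (lam * t) < absDetOn (A t x) (F x)

/-- `E ⊕ F` is a partially hyperbolic splitting: it is dominated, and `E` is uniformly contracted
or `F` is uniformly expanded. -/
def IsPartiallyHyperbolic [TopologicalSpace M]
    (IsCont : Set M → (∀ x, G x) → Prop) (φ : ℝ → M → M)
    (A : ∀ (t : ℝ) (x : M), G x →ₗ[ℝ] G (φ t x)) (Γ : Set M)
    (E F : ∀ x, Submodule ℝ (G x)) : Prop :=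
  IsDominatedSplitting IsCont φ A Γ E F ∧
    (UniformlyContracted φ A Γ E ∨ UniformlyExpanded φ A Γ F)

/-- `E ⊕ F` is a singular hyperbolic splitting: it is dominated, `E` is uniformly contracted and
the central subbundle `F` is volume expanding. -/
def IsSingularHyperbolic [TopologicalSpace M]
    (IsCont : Set M → (∀ x, G x) → Prop) (φ : ℝ → M → M)
    (A : ∀ (t : ℝ) (x : M), G x →ₗ[ℝ] G (φ t x)) (Γ : Set M)
    (E F : ∀ x, Submodule ℝ (G x)) : Prop :=
  IsDominatedSplitting IsCont φ A Γ E F ∧ UniformlyContracted φ A Γ E ∧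
    VolumeExpanding φ A Γ F

end Cocycle

/-! ### The flow of a vector field and its derivative -/

section Flow

variable {V : Type*} [NormedAddCommGroup V] [NormedSpace ℝ V]
  {H : Type*} [TopologicalSpace H] (I : ModelWithCorners ℝ V H)
  {M : Type*} [TopologicalSpace M] [ChartedSpace H M]

instance finiteDimensional_tangentSpace [FiniteDimensional ℝ V] (x : M) : FiniteDimensional ℝ (TangentSpace I x) :=
  inferInstanceAs (FiniteDimensional ℝ V)

/-- `φ` is the flow generated by `X`: for each `x` the curve `t ↦ φ t x`, `t ≥ 0`, is the integral
curve of `X` starting at `x`, and `φ (-t)` inverts `φ t`. (On a manifold with boundary `φ t` need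
not be onto when `t > 0`, and then `φ (-t)` is meaningful only on the image of `φ t`.) -/
structure IsFlowOf (X : ∀ x : M, TangentSpace I x) (φ : ℝ → M → M) : Prop where
  zero : ∀ x, φ 0 x = x
  integralCurve : ∀ x, IsMIntegralCurveOn (fun t => φ t x) X (Ici (0 : ℝ))
  neg_apply : ∀ t, 0 ≤ t → ∀ x, φ (-t) (φ t x) = x

/-- The derivative cocycle `DX_t` on the tangent bundle. -/
def derivCocycle (φ : ℝ → M → M) (t : ℝ) (x : M) :
    TangentSpace I x →ₗ[ℝ] TangentSpace I (φ t x) :=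
  (mfderiv I I (φ t) x).toLinearMap

/-- The cocycle `⋀^k DX_t` on the `k`-th exterior power of the tangent bundle. -/
def wedgeCocycle (k : ℕ) (φ : ℝ → M → M) (t : ℝ) (x : M) :
    ⋀[ℝ]^k (TangentSpace I x) →ₗ[ℝ] ⋀[ℝ]^k (TangentSpace I (φ t x)) :=
  exteriorPower.map k (derivCocycle I φ t x)

/-- `s` is a continuous section of the tangent bundle over `W`. -/
def IsContVectorField [IsManifold I 1 M] (W : Set M) (s : ∀ x : M, TangentSpace I x) : Prop :=
  ContinuousOn (fun x => (⟨x, s x⟩ : TangentBundle I M)) W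

/-- `w` is a continuous section over `W` of the `k`-th exterior power of the tangent bundle: in the
local trivializations of `⋀^k TM` induced by those of `TM`, its coordinates are continuous. -/
def IsContMultivectorField [IsManifold I 1 M] (k : ℕ) (W : Set M)
    (w : ∀ x : M, ⋀[ℝ]^k (TangentSpace I x)) : Prop :=
  ∀ x₀ ∈ W, ∀ ℓ : ⋀[ℝ]^k V →ₗ[ℝ] ℝ,
    ContinuousWithinAt (fun x => ℓ (exteriorPower.map k
      ((trivializationAt V (fun y : M => TangentSpace I y) x₀).linearMapAt ℝ x) (w x))) W x₀

end Flow

end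

/-! Fix `x ∈ Γ` and `t > 0`, and let `f₁, …, f_k` be an orthonormal basis of `F x` with orthogonal
images under `DX_t` (the right singular vectors of `DX_t|F`), of lengths `σ₁, …, σ_k`. The line
`⋀^k F x` is spanned by `f₁ ∧ ⋯ ∧ f_k`, whose image has norm `σ₁ ⋯ σ_k = |det (DX_t|F)|`; hence the
norm of `⋀^k DX_{-t}` on `⋀^k F` is exactly `|det (DX_t|F)|⁻¹`, which is (1).

For (2), let `α = ‖DX_t|E‖` and `β = ‖DX_{-t}|F‖ = (min σᵢ)⁻¹`. A wedge of basis vectors of `E` and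
`F` with `m ≥ 1` factors in `E` comes from `f₁ ∧ ⋯ ∧ f_k` by trading `m` of the `fᵢ` for vectors of
`E`, and each trade costs at most a factor `αβ`; so domination of `E ⊕ F` gives domination of
`Ẽ ⊕ F̃`. Conversely, trading the single `fᵢ` with the smallest `σᵢ` for a vector of `E` recovers
`αβ` from the wedge norms. Both directions lose a constant depending on the angle between `E` and
`F`, which is bounded below because `Γ` is compact and the splitting is continuous. -/

open Module Submodule Function exteriorPower

section ExteriorProductsOfSubspaces

variable {V W : Type*} [AddCommGroup V] [Module ℝ V] [AddCommGroup W] [Module ℝ W] {k : ℕ}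

theorem ιMulti_mem_wedgeSub {F : Submodule ℝ V} {v : Fin k → V} (hv : ∀ i, v i ∈ F) :
    ιMulti ℝ k v ∈ wedgeSub k F :=
  subset_span ⟨v, hv, rfl⟩

theorem ιMulti_mem_mixedSub {E F : Submodule ℝ V} {v : Fin k → V} (hv : ∀ i, v i ∈ E ∨ v i ∈ F)
    {i₀ : Fin k} (hi₀ : v i₀ ∈ E) : ιMulti ℝ k v ∈ mixedSub k E F :=
  subset_span ⟨v, hv, ⟨i₀, hi₀⟩, rfl⟩

theorem map_wedgeSub (T : V →ₗ[ℝ] W) (k : ℕ) (F : Submodule ℝ V) :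
    (wedgeSub k F).map (exteriorPower.map k T) = wedgeSub k (F.map T) := by
  rw [wedgeSub, Submodule.map_span]
  refine le_antisymm (span_le.mpr ?_) (span_le.mpr ?_)
  · rintro _ ⟨_, ⟨v, hv, rfl⟩, rfl⟩
    rw [map_apply_ιMulti]
    exact ιMulti_mem_wedgeSub fun i => mem_map_of_mem (hv i)
  · rintro _ ⟨v, hv, rfl⟩
    choose u hu huv using hv
    obtain rfl : T ∘ u = v := funext huv
    exact subset_span ⟨_, ⟨u, hu, rfl⟩, map_apply_ιMulti T u⟩

theorem map_mixedSub (T : V →ₗ[ℝ] W) (k : ℕ) (E F : Submodule ℝ V) :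
    (mixedSub k E F).map (exteriorPower.map k T) = mixedSub k (E.map T) (F.map T) := by
  rw [mixedSub, Submodule.map_span]
  refine le_antisymm (span_le.mpr ?_) (span_le.mpr ?_)
  · rintro _ ⟨_, ⟨v, hv, ⟨i₀, hi₀⟩, rfl⟩, rfl⟩
    rw [map_apply_ιMulti]
    exact ιMulti_mem_mixedSub (fun i => (hv i).imp mem_map_of_mem mem_map_of_mem)
      (mem_map_of_mem hi₀)
  · rintro _ ⟨v, hv, ⟨i₀, e, he, hei₀⟩, rfl⟩
    have hlift : ∀ i, ∃ u, (u ∈ E ∨ u ∈ F) ∧ T u = v i := fun i => by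
      rcases hv i with ⟨u, hu, huv⟩ | ⟨u, hu, huv⟩
      exacts [⟨u, .inl hu, huv⟩, ⟨u, .inr hu, huv⟩]
    choose u hu huv using hlift
    have hTu : T ∘ update u i₀ e = v := by
      rw [comp_update, hei₀, show T ∘ u = v from funext huv, update_eq_self]
    refine subset_span ⟨_, ⟨update u i₀ e, fun i => ?_, ⟨i₀, ?_⟩, rfl⟩, ?_⟩
    · rcases eq_or_ne i i₀ with rfl | hi
      · rw [update_self]; exact .inl he
      · rw [update_of_ne hi]; exact hu i
    · rwa [update_self]
    · rw [map_apply_ιMulti, hTu]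

section SpanOfBasisVectors

variable {ι : Type*} [LinearOrder ι] (b : Basis ι ℝ V) (J : Set ι)

theorem ιMulti_mem_span_image_basis_iff {v : Fin k → V} {S : Set (powersetCard ι k)} :
    ιMulti ℝ k v ∈ span ℝ (ιMulti_family ℝ k b '' S) ↔
      ∀ s ∉ S, (Matrix.of fun i j => b.coord (powersetCard.ofFinEmbEquiv.symm s j) (v i)).det
        = 0 := by
  rw [← coe_basis, Basis.mem_span_image]
  refine forall_congr' fun s => ?_
  rw [Finset.mem_coe, Finsupp.mem_support_iff, basis_repr_apply, ιMultiDual_apply_ιMulti,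
    not_imp_comm]

theorem wedgeSub_span_basis :
    wedgeSub k (span ℝ (b '' Jᶜ)) =
      span ℝ (ιMulti_family ℝ k b '' {s | ∃ i ∈ s, i ∈ J}ᶜ) := by
  refine le_antisymm (span_le.mpr ?_) (span_le.mpr ?_)
  · rintro _ ⟨v, hv, rfl⟩
    rw [SetLike.mem_coe, ιMulti_mem_span_image_basis_iff]
    rintro s hs
    obtain ⟨i, his, hiJ⟩ := not_not.mp hs
    obtain ⟨j, rfl⟩ := (powersetCard.mem_range_ofFinEmbEquiv_symm_iff_mem s i).mpr his
    refine Matrix.det_eq_zero_of_column_eq_zero j fun l => ?_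
    by_contra h
    exact b.mem_span_image.mp (hv l) (Finsupp.mem_support_iff.mpr h) hiJ
  · rintro _ ⟨s, hs, rfl⟩
    refine ιMulti_mem_wedgeSub fun j => subset_span (mem_image_of_mem b fun hj => hs ?_)
    exact ⟨_, (powersetCard.mem_range_ofFinEmbEquiv_symm_iff_mem s _).mp ⟨j, rfl⟩, hj⟩

theorem mixedSub_span_basis :
    mixedSub k (span ℝ (b '' J)) (span ℝ (b '' Jᶜ)) =
      span ℝ (ιMulti_family ℝ k b '' {s | ∃ i ∈ s, i ∈ J}) := by
  refine le_antisymm (span_le.mpr ?_) (span_le.mpr ?_)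
  · rintro _ ⟨v, -, ⟨l, hl⟩, rfl⟩
    rw [SetLike.mem_coe, ιMulti_mem_span_image_basis_iff]
    refine fun s hs => Matrix.det_eq_zero_of_row_eq_zero l fun j => ?_
    by_contra h
    exact hs ⟨_, (powersetCard.mem_range_ofFinEmbEquiv_symm_iff_mem s _).mp ⟨j, rfl⟩,
      b.mem_span_image.mp hl (Finsupp.mem_support_iff.mpr h)⟩
  · rintro _ ⟨s, ⟨i, his, hi⟩, rfl⟩
    obtain ⟨j, rfl⟩ := (powersetCard.mem_range_ofFinEmbEquiv_symm_iff_mem s i).mpr his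
    refine ιMulti_mem_mixedSub (fun l => ?_) (subset_span (mem_image_of_mem b hi))
    exact (em (powersetCard.ofFinEmbEquiv.symm s l ∈ J)).imp
      (fun h => subset_span (mem_image_of_mem b h)) fun h => subset_span (mem_image_of_mem b h)

end SpanOfBasisVectors

section BasisOfIsCompl

variable {E F : Submodule ℝ V} (h : IsCompl E F) {ι κ : Type*} (e : Basis ι ℝ E) (f : Basis κ ℝ F)

/-- The basis of `V = E ⊕ F` formed by a basis of `E` followed by a basis of `F`. The index type
carries the lexicographic order because bases of `⋀^k V` are indexed by subsets of a linear
order. -/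
noncomputable def basisOfIsCompl : Basis (ι ⊕ₗ κ) ℝ V :=
  ((e.prod f).map (E.prodEquivOfIsCompl F h)).reindex toLex

@[simp]
theorem basisOfIsCompl_inl (i : ι) : basisOfIsCompl h e f (Sum.inlₗ i) = e i := by
  simp [basisOfIsCompl]

@[simp]
theorem basisOfIsCompl_inr (j : κ) : basisOfIsCompl h e f (Sum.inrₗ j) = f j := by
  simp [basisOfIsCompl]

theorem compl_range_inlₗ : (range (Sum.inlₗ : ι → ι ⊕ₗ κ))ᶜ = range Sum.inrₗ :=
  compl_range_inl

theorem span_range_coe_basis {S : Submodule ℝ V} (b : Basis ι ℝ S) :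
    span ℝ (range fun i => (b i : V)) = S := by
  have hb := congrArg (Submodule.map S.subtype) b.span_eq
  rwa [Submodule.map_span, ← range_comp, Submodule.map_top, range_subtype] at hb

theorem span_basisOfIsCompl_image_inl :
    span ℝ (basisOfIsCompl h e f '' range Sum.inlₗ) = E := by
  simp only [← range_comp, comp_def, basisOfIsCompl_inl, span_range_coe_basis]

theorem span_basisOfIsCompl_image_compl_inl :
    span ℝ (basisOfIsCompl h e f '' (range Sum.inlₗ)ᶜ) = F := by
  simp only [compl_range_inlₗ, ← range_comp, comp_def, basisOfIsCompl_inr, span_range_coe_basis]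

variable [LinearOrder ι] [LinearOrder κ]

theorem wedgeSub_eq_span_basisOfIsCompl :
    wedgeSub k F = span ℝ (ιMulti_family ℝ k (basisOfIsCompl h e f) ''
      {s | ∃ i ∈ s, i ∈ range Sum.inlₗ}ᶜ) := by
  rw [← wedgeSub_span_basis, span_basisOfIsCompl_image_compl_inl]

theorem mixedSub_eq_span_basisOfIsCompl :
    mixedSub k E F = span ℝ (ιMulti_family ℝ k (basisOfIsCompl h e f) ''
      {s | ∃ i ∈ s, i ∈ range Sum.inlₗ}) := by
  rw [← mixedSub_span_basis, span_basisOfIsCompl_image_inl, span_basisOfIsCompl_image_compl_inl]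

end BasisOfIsCompl

theorem wedgeSub_eq_range (k : ℕ) (F : Submodule ℝ V) :
    wedgeSub k F = LinearMap.range (exteriorPower.map k F.subtype) := by
  rw [LinearMap.range_eq_map, ← ιMulti_span, Submodule.map_span, ← range_comp, wedgeSub]
  congr 1
  ext w
  constructor
  · rintro ⟨v, hv, rfl⟩
    exact ⟨fun i => ⟨v i, hv i⟩, map_apply_ιMulti _ _⟩
  · rintro ⟨v, rfl⟩
    exact ⟨F.subtype ∘ v, fun i => (v i).2, map_apply_ιMulti _ _⟩

theorem ιMulti_ne_zero {v : Fin k → V} (hv : LinearIndependent ℝ v) : ιMulti ℝ k v ≠ 0 := by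
  have h := (ιMulti_family_linearIndependent_field k hv).ne_zero
    (powersetCard.ofFinEmbEquiv (RelEmbedding.refl _))
  rwa [ιMulti_family, Equiv.symm_apply_apply] at h

section Finrank

variable {E F : Submodule ℝ V}

theorem finrank_wedgeSub [FiniteDimensional ℝ F] :
    finrank ℝ (wedgeSub k F) = (finrank ℝ F).choose k := by
  rw [wedgeSub_eq_range, LinearMap.finrank_range_of_inj (map_injective_field F.subtype_injective),
    exteriorPower.finrank_eq]

theorem wedgeSub_eq_span_singleton (f : Basis (Fin k) ℝ F) :
    wedgeSub k F = span ℝ {ιMulti ℝ k fun i => (f i : V)} := by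
  have : Module.Finite ℝ F := .of_basis f
  have hf : ιMulti ℝ k (fun i => (f i : V)) ≠ 0 :=
    ιMulti_ne_zero (f.linearIndependent.map' F.subtype F.ker_subtype)
  have : Module.Finite ℝ (wedgeSub k F) := by rw [wedgeSub_eq_range]; infer_instance
  refine (eq_of_le_of_finrank_eq ?_ ?_).symm
  · exact span_le.mpr (singleton_subset_iff.mpr (ιMulti_mem_wedgeSub fun i => (f i).2))
  · rw [finrank_span_singleton hf, finrank_wedgeSub, finrank_eq_card_basis f, Fintype.card_fin,
      Nat.choose_self]

variable [FiniteDimensional ℝ V]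

theorem isCompl_mixedSub_wedgeSub (h : IsCompl E F) (k : ℕ) :
    IsCompl (mixedSub k E F) (wedgeSub k F) := by
  set b := basisOfIsCompl h (finBasis ℝ E) (finBasis ℝ F)
  rw [mixedSub_eq_span_basisOfIsCompl h (finBasis ℝ E) (finBasis ℝ F),
    wedgeSub_eq_span_basisOfIsCompl h (finBasis ℝ E) (finBasis ℝ F), ← coe_basis]
  constructor
  · exact (b.exteriorPower k).linearIndependent.disjoint_span_image disjoint_compl_right
  · rw [codisjoint_iff, ← span_union, ← image_union, union_compl_self, image_univ]
    exact (b.exteriorPower k).span_eq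

theorem wedgeSub_ne_bot (hF : finrank ℝ F = k) : wedgeSub k F ≠ ⊥ := by
  rw [Ne, ← finrank_eq_zero (R := ℝ), finrank_wedgeSub, hF, Nat.choose_self]
  exact one_ne_zero

theorem mixedSub_ne_bot_iff (h : IsCompl E F) (hk : k ≠ 0) (hF : finrank ℝ F = k) :
    mixedSub k E F ≠ ⊥ ↔ E ≠ ⊥ := by
  have hsum := finrank_add_eq_of_isCompl h
  have hchoose := finrank_add_eq_of_isCompl (isCompl_mixedSub_wedgeSub h k)
  rw [finrank_wedgeSub, hF, Nat.choose_self, exteriorPower.finrank_eq] at hchoose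
  rw [not_iff_not, ← finrank_eq_zero (R := ℝ), ← finrank_eq_zero (R := ℝ) (S := E)]
  have := Nat.choose_eq_one_iff (n := finrank ℝ V) (k := k)
  omega

end Finrank

end ExteriorProductsOfSubspaces

section RestrictNorm

variable {V W : Type*} [NormedAddCommGroup V] [NormedSpace ℝ V] [FiniteDimensional ℝ V]
  [NormedAddCommGroup W] [NormedSpace ℝ W] (T : V →ₗ[ℝ] W)

theorem restrictNorm_nonneg (S : Submodule ℝ V) : 0 ≤ restrictNorm T S :=
  norm_nonneg (T ∘ₗ S.subtype).toContinuousLinearMap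

variable {T} in
theorem norm_apply_le_restrictNorm_mul {S : Submodule ℝ V} {v : V} (hv : v ∈ S) :
    ‖T v‖ ≤ restrictNorm T S * ‖v‖ :=
  (T ∘ₗ S.subtype).toContinuousLinearMap.le_opNorm ⟨v, hv⟩

variable {T} in
theorem restrictNorm_le {S : Submodule ℝ V} {c : ℝ} (hc : 0 ≤ c)
    (h : ∀ v ∈ S, ‖T v‖ ≤ c * ‖v‖) : restrictNorm T S ≤ c :=
  ContinuousLinearMap.opNorm_le_bound _ hc fun v => h v v.2

theorem restrictNorm_span_singleton_mul_norm (w : V) :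
    restrictNorm T (span ℝ {w}) * ‖w‖ = ‖T w‖ := by
  refine le_antisymm ?_ (norm_apply_le_restrictNorm_mul (mem_span_singleton_self w))
  rcases eq_or_ne w 0 with rfl | hw
  · simp
  have hw' : 0 < ‖w‖ := norm_pos_iff.mpr hw
  rw [← le_div_iff₀ hw']
  refine restrictNorm_le (by positivity) fun v hv => ?_
  obtain ⟨a, rfl⟩ := mem_span_singleton.mp hv
  rw [map_smul, norm_smul, norm_smul]
  apply le_of_eq
  field_simp

theorem restrictNorm_span_image_basis_le {ι : Type*} [Fintype ι] (b : Basis ι ℝ V) (s : Set ι)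
    {c D : ℝ} (hc : 0 ≤ c) (hD : 0 ≤ D) (hb : ∀ i v, |b.coord i v| ≤ c * ‖v‖)
    (hT : ∀ i ∈ s, ‖T (b i)‖ ≤ D) :
    restrictNorm T (span ℝ (b '' s)) ≤ Fintype.card ι * (c * D) := by
  refine restrictNorm_le (by positivity) fun v hv => ?_
  have hterm : ∀ i ∈ Finset.univ, ‖b.repr v i • T (b i)‖ ≤ c * ‖v‖ * D := fun i _ => by
    rw [norm_smul]
    by_cases hi : b.repr v i = 0
    · rw [hi, norm_zero, zero_mul]
      positivity
    · exact mul_le_mul (hb i v) (hT i (b.mem_span_image.mp hv (Finsupp.mem_support_iff.mpr hi)))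
        (norm_nonneg _) (by positivity)
  calc ‖T v‖ = ‖∑ i, b.repr v i • T (b i)‖ := by
        conv_lhs => rw [← b.sum_repr v]
        simp only [map_sum, map_smul]
    _ ≤ ∑ _i : ι, c * ‖v‖ * D := norm_sum_le_of_le _ hterm
    _ = Fintype.card ι * (c * D) * ‖v‖ := by
        rw [Finset.sum_const, Finset.card_univ, nsmul_eq_mul]
        ring

end RestrictNorm

section NormOfWedge

variable {V : Type*} [NormedAddCommGroup V] [InnerProductSpace ℝ V] [FiniteDimensional ℝ V]
  {k : ℕ}

theorem norm_ιMulti_sq (v : Fin k → V) : ‖ιMulti ℝ k v‖ ^ 2 = (Matrix.gram ℝ v).det := by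
  rw [← inner_ιMulti_self, real_inner_self_eq_norm_sq]

theorem norm_ιMulti_of_orthogonal {v : Fin k → V}
    (hv : Pairwise fun i j => inner ℝ (v i) (v j) = 0) : ‖ιMulti ℝ k v‖ = ∏ i, ‖v i‖ := by
  have hgram : Matrix.gram ℝ v = Matrix.diagonal fun i => ‖v i‖ ^ 2 := by
    ext i j
    rcases eq_or_ne i j with rfl | hij
    · simp
    · simp [hij, hv hij]
  rw [← sq_eq_sq₀ (norm_nonneg _) (Finset.prod_nonneg fun _ _ => norm_nonneg _), norm_ιMulti_sq,
    hgram, Matrix.det_diagonal, Finset.prod_pow]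

theorem norm_ιMulti_le (v : Fin k → V) : ‖ιMulti ℝ k v‖ ≤ √k.factorial * ∏ i, ‖v i‖ := by
  set u : Fin k → V := fun i => ‖v i‖⁻¹ • v i
  have hu : ∀ i, ‖u i‖ ≤ 1 := fun i => by
    rw [norm_smul, norm_inv, norm_norm]
    exact inv_mul_le_one
  have huv : v = fun i => ‖v i‖ • u i := by
    ext i
    rcases eq_or_ne (v i) 0 with h | h
    · simp [h]
    · exact (smul_inv_smul₀ (norm_ne_zero_iff.mpr h) (v i)).symm
  have hwedge : ‖ιMulti ℝ k u‖ ≤ √k.factorial := by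
    refine Real.le_sqrt_of_sq_le ?_
    rw [norm_ιMulti_sq]
    refine (le_abs_self _).trans ?_
    simpa using Matrix.det_le (A := Matrix.gram ℝ u) (abv := .abs) (x := 1) fun i j =>
      (abs_real_inner_le_norm _ _).trans (mul_le_one₀ (hu i) (norm_nonneg _) (hu j))
  conv_lhs => rw [huv]
  rw [AlternatingMap.map_smul_univ, norm_smul, norm_prod, mul_comm]
  simp only [norm_norm]
  gcongr

theorem norm_ιMulti_family_le {ι : Type*} [LinearOrder ι] (v : ι → V) (s : powersetCard ι k) :
    ‖ιMulti_family ℝ k v s‖ ≤ √k.factorial * ∏ i ∈ (s : Finset ι), ‖v i‖ := by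
  have hs : (s : Finset ι) = Finset.univ.map (powersetCard.ofFinEmbEquiv.symm s).toEmbedding := by
    ext i
    rw [powersetCard.mem_coe_iff, ← powersetCard.mem_range_ofFinEmbEquiv_symm_iff_mem]
    simp
  rw [hs, Finset.prod_map]
  exact norm_ιMulti_le _

theorem norm_apply_le_of_orthonormal {Z : Type*} [SeminormedAddCommGroup Z] [NormedSpace ℝ Z]
    (L : ⋀[ℝ]^k V →ₗ[ℝ] Z) {a : ℝ}
    (hL : ∀ v : Fin k → V, Orthonormal ℝ v → ‖L (ιMulti ℝ k v)‖ ≤ a) (w : ⋀[ℝ]^k V) :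
    ‖L w‖ ≤ (finrank ℝ V).choose k * a * ‖w‖ := by
  set o := stdOrthonormalBasis ℝ V
  have ho : ∀ t, ‖L (o.exteriorPower k t)‖ ≤ a := fun t => by
    rw [← OrthonormalBasis.coe_toBasis, OrthonormalBasis.toBasis_exteriorPower, basis_apply]
    exact hL _ (o.coe_toBasis ▸ o.orthonormal.comp _ (RelEmbedding.injective _))
  calc ‖L w‖ = ‖∑ t, inner ℝ (o.exteriorPower k t) w • L (o.exteriorPower k t)‖ := by
        conv_lhs => rw [← (o.exteriorPower k).sum_repr' w]
        simp only [map_sum, map_smul]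
    _ ≤ ∑ _t : powersetCard (Fin (finrank ℝ V)) k, ‖w‖ * a := by
        refine norm_sum_le_of_le _ fun t _ => ?_
        rw [norm_smul]
        refine mul_le_mul ?_ (ho t) (norm_nonneg _) (norm_nonneg _)
        simpa using norm_inner_le_norm (𝕜 := ℝ) (o.exteriorPower k t) w
    _ = _ := by
        rw [Finset.sum_const, Finset.card_univ,
          ← finrank_eq_card_basis (o.exteriorPower k).toBasis, exteriorPower.finrank_eq,
          nsmul_eq_mul]
        ring

theorem abs_coord_exteriorPower_le {ι : Type*} [LinearOrder ι] (b : Basis ι ℝ V) {c : ℝ}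
    (hb : ∀ i v, |b.coord i v| ≤ c * ‖v‖) (s : powersetCard ι k) (w : ⋀[ℝ]^k V) :
    |(b.exteriorPower k).coord s w| ≤
      (finrank ℝ V).choose k * (k.factorial * c ^ k) * ‖w‖ := by
  refine norm_apply_le_of_orthonormal ((b.exteriorPower k).coord s) (fun v hv => ?_) w
  rw [basis_coord, ιMultiDual_apply_ιMulti, ← nsmul_eq_mul]
  simpa using Matrix.det_le
    (A := Matrix.of fun i j => b.coord (powersetCard.ofFinEmbEquiv.symm s j) (v i))
    (abv := .abs) (x := c) fun i j => by
      simpa [hv.1] using hb (powersetCard.ofFinEmbEquiv.symm s j) (v i)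

theorem restrictNorm_span_ιMulti_family_le {Z : Type*} [NormedAddCommGroup Z] [NormedSpace ℝ Z]
    {ι : Type*} [LinearOrder ι] (b : Basis ι ℝ V) (L : ⋀[ℝ]^k V →ₗ[ℝ] Z)
    (s : Set (powersetCard ι k)) {c D : ℝ} (hc : 0 ≤ c) (hD : 0 ≤ D)
    (hb : ∀ i v, |b.coord i v| ≤ c * ‖v‖) (hL : ∀ i ∈ s, ‖L (ιMulti_family ℝ k b i)‖ ≤ D) :
    restrictNorm L (span ℝ (ιMulti_family ℝ k b '' s)) ≤
      (finrank ℝ V).choose k ^ 2 * (k.factorial * c ^ k) * D := by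
  have : Finite ι := Module.Finite.finite_basis b
  have : Fintype ι := Fintype.ofFinite ι
  have hcard : Fintype.card (powersetCard ι k) = (finrank ℝ V).choose k := by
    rw [← finrank_eq_card_basis (b.exteriorPower k), exteriorPower.finrank_eq]
  rw [← coe_basis] at hL ⊢
  refine (restrictNorm_span_image_basis_le L (b.exteriorPower k) s (by positivity) hD
    (abs_coord_exteriorPower_le b hb) hL).trans_eq ?_
  rw [hcard]
  ring

end NormOfWedge

section Volume

variable {V W Z : Type*}
  [NormedAddCommGroup V] [InnerProductSpace ℝ V] [FiniteDimensional ℝ V]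
  [NormedAddCommGroup W] [InnerProductSpace ℝ W] [NormedAddCommGroup Z] [InnerProductSpace ℝ Z]
  {T : V →ₗ[ℝ] W} {S : W →ₗ[ℝ] Z} {F : Submodule ℝ V} {k : ℕ}

theorem absDetOn_eq_normDet (T : V →ₗ[ℝ] W) (F : Submodule ℝ V) :
    absDetOn T F = (T ∘ₗ F.subtype).normDet := by
  have h := (T ∘ₗ F.subtype).normDet_sq_eq_det_gram (stdOrthonormalBasis ℝ F)
  rw [RCLike.ofReal_real_eq_id, id] at h
  rw [← Real.sqrt_sq (T ∘ₗ F.subtype).normDet_nonneg, h]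
  rfl

theorem absDetOn_eq_one (hT : ∀ v ∈ F, ‖T v‖ = ‖v‖) : absDetOn T F = 1 := by
  rw [absDetOn_eq_normDet]
  exact LinearIsometry.normDet_eq_one ⟨T ∘ₗ F.subtype, fun v => hT v v.2⟩

variable [FiniteDimensional ℝ W]

theorem absDetOn_eq_norm_ιMulti (T : V →ₗ[ℝ] W) (f : OrthonormalBasis (Fin k) ℝ F) :
    absDetOn T F = ‖ιMulti ℝ k fun i => T (f i)‖ := by
  rw [absDetOn_eq_normDet, ← sq_eq_sq₀ (LinearMap.normDet_nonneg _) (norm_nonneg _),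
    norm_ιMulti_sq]
  exact (T ∘ₗ F.subtype).normDet_sq_eq_det_gram f

theorem absDetOn_eq_prod_norm (f : OrthonormalBasis (Fin k) ℝ F)
    (hf : Pairwise fun i j => inner ℝ (T (f i)) (T (f j)) = 0) :
    absDetOn T F = ∏ i, ‖T (f i)‖ := by
  rw [absDetOn_eq_norm_ιMulti, norm_ιMulti_of_orthogonal hf]

theorem restrictNorm_wedgeSub_mul_absDetOn [FiniteDimensional ℝ Z] (hF : finrank ℝ F = k)
    (hST : ∀ v ∈ F, ‖S (T v)‖ = ‖v‖) :
    restrictNorm (exteriorPower.map k S) (wedgeSub k (F.map T)) * absDetOn T F = 1 := by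
  subst hF
  let f := stdOrthonormalBasis ℝ F
  have himage : wedgeSub (finrank ℝ F) (F.map T) = span ℝ {ιMulti ℝ _ fun i => T (f i)} := by
    rw [← map_wedgeSub, wedgeSub_eq_span_singleton f.toBasis, Submodule.map_span,
      image_singleton, map_apply_ιMulti, f.coe_toBasis]
    rfl
  rw [himage, absDetOn_eq_norm_ιMulti T f, restrictNorm_span_singleton_mul_norm,
    map_apply_ιMulti, ← absDetOn_eq_one (T := S ∘ₗ T) hST, absDetOn_eq_norm_ιMulti (S ∘ₗ T) f]
  rfl

/-- These are the right singular vectors of `T|F`: the eigenvectors of `(T|F)* (T|F)`. -/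
theorem exists_orthonormalBasis_orthogonal_image (T : V →ₗ[ℝ] W) (hF : finrank ℝ F = k) :
    ∃ f : OrthonormalBasis (Fin k) ℝ F,
      Pairwise fun i j => inner ℝ (T (f i)) (T (f j)) = 0 := by
  set U : F →ₗ[ℝ] W := T ∘ₗ F.subtype
  have hU := U.isPositive_adjoint_comp_self.isSymmetric
  refine ⟨hU.eigenvectorBasis hF, fun i j hij => ?_⟩
  change inner ℝ (U (hU.eigenvectorBasis hF i)) (U (hU.eigenvectorBasis hF j)) = 0
  rw [← LinearMap.adjoint_inner_left, ← LinearMap.comp_apply, hU.apply_eigenvectorBasis,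
    inner_smul_left, OrthonormalBasis.inner_eq_zero _ hij, mul_zero]

end Volume

section AngleBound

/-- The angle between `E` and `F` is bounded below: where `V = E ⊕ F`, the projection onto `E`
along `F` has norm at most `c`. -/
def HasAngleBound {V : Type*} [SeminormedAddCommGroup V] [Module ℝ V] (c : ℝ)
    (E F : Submodule ℝ V) : Prop :=
  ∀ e ∈ E, ∀ f ∈ F, ‖e‖ ≤ c * ‖e + f‖

namespace HasAngleBound

variable {V : Type*} [NormedAddCommGroup V] [InnerProductSpace ℝ V] {c : ℝ} {E F : Submodule ℝ V}

theorem norm_right_le (h : HasAngleBound c E F) {e f : V} (he : e ∈ E) (hf : f ∈ F) :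
    ‖f‖ ≤ (1 + c) * ‖e + f‖ := by
  have hsub := norm_sub_le (e + f) e
  rw [add_sub_cancel_left] at hsub
  linarith [h e he f hf]

theorem abs_coord_basisOfIsCompl_le (h : HasAngleBound c E F) (hEF : IsCompl E F)
    {ι κ : Type*} [Fintype ι] [Fintype κ] (e : OrthonormalBasis ι ℝ E)
    (f : OrthonormalBasis κ ℝ F) (i : ι ⊕ₗ κ) (v : V) :
    |(basisOfIsCompl hEF e.toBasis f.toBasis).coord i v| ≤ (1 + c) * ‖v‖ := by
  obtain ⟨⟨x, y⟩, rfl⟩ := (E.prodEquivOfIsCompl F hEF).surjective v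
  have hxy : E.prodEquivOfIsCompl F hEF (x, y) = x + y := coe_prodEquivOfIsCompl' E F hEF (x, y)
  rw [Basis.coord_apply, basisOfIsCompl, Basis.repr_reindex_apply, Basis.map_repr,
    LinearEquiv.trans_apply, LinearEquiv.symm_apply_apply, hxy]
  obtain ⟨i, rfl⟩ := toLex.surjective i
  rcases i with i | i
  · calc _ = ‖e.repr x i‖ := by simp
      _ ≤ ‖(x : V)‖ := (PiLp.norm_apply_le _ i).trans_eq (e.repr.norm_map x)
      _ ≤ _ := by linarith [norm_nonneg ((x : V) + y), h x x.2 y y.2]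
  · calc _ = ‖f.repr y i‖ := by simp
      _ ≤ ‖(y : V)‖ := (PiLp.norm_apply_le _ i).trans_eq (f.repr.norm_map y)
      _ ≤ _ := h.norm_right_le x.2 y.2

end HasAngleBound

end AngleBound

section OrthogonalSystems

variable {V W : Type*} [NormedAddCommGroup V] [InnerProductSpace ℝ V]
  [NormedAddCommGroup W] [InnerProductSpace ℝ W] {F : Submodule ℝ V} {T : V →ₗ[ℝ] W} {k : ℕ}

theorem norm_sum_sq_of_orthogonal {ι : Type*} [Fintype ι] {w : ι → W}
    (hw : Pairwise fun i j => inner ℝ (w i) (w j) = 0) : ‖∑ i, w i‖ ^ 2 = ∑ i, ‖w i‖ ^ 2 := by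
  rw [← real_inner_self_eq_norm_sq, sum_inner]
  refine Finset.sum_congr rfl fun i _ => ?_
  rw [inner_sum, Finset.sum_eq_single i (fun j _ hj => hw hj.symm) (by simp),
    real_inner_self_eq_norm_sq]

theorem mul_norm_le_norm_map_of_orthogonal {ι : Type*} [Fintype ι] (f : OrthonormalBasis ι ℝ F)
    (hf : Pairwise fun i j => inner ℝ (T (f i)) (T (f j)) = 0) {σ : ℝ} (hσ₀ : 0 ≤ σ)
    (hσ : ∀ i, σ ≤ ‖T (f i)‖) {v : V} (hv : v ∈ F) : σ * ‖v‖ ≤ ‖T v‖ := by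
  lift v to F using hv
  have hTv : T v = ∑ i, inner ℝ (f i) v • T (f i) := by
    conv_lhs => rw [← f.sum_repr' v]
    simp only [Submodule.coe_sum, coe_smul, map_sum, map_smul]
  have horth : Pairwise fun i j =>
      inner ℝ (inner ℝ (f i) v • T (f i)) (inner ℝ (f j) v • T (f j)) = 0 := fun i j hij => by
    simp only [inner_smul_left, inner_smul_right, hf hij, mul_zero]
  rw [← pow_le_pow_iff_left₀ (by positivity) (norm_nonneg _) two_ne_zero, mul_pow, norm_coe,
    ← f.sum_sq_norm_inner_right, Finset.mul_sum, hTv, norm_sum_sq_of_orthogonal horth]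
  refine Finset.sum_le_sum fun i _ => ?_
  rw [norm_smul, mul_pow, mul_comm]
  gcongr
  exact hσ i

theorem ιMulti_update_sub_of_mem_span {V : Type*} [AddCommGroup V] [Module ℝ V]
    (g : Fin k → V) {i₀ : Fin k} (x : V) {p : V} (hp : p ∈ span ℝ (g '' {i₀}ᶜ)) :
    ιMulti ℝ k (update g i₀ (x - p)) = ιMulti ℝ k (update g i₀ x) := by
  rw [AlternatingMap.map_update_sub, sub_eq_self]
  refine AlternatingMap.map_linearDependent _ _ fun h => ?_
  refine h.notMem_span_image (notMem_compl_iff.mpr (mem_singleton i₀)) ?_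
  have himage : update g i₀ p '' {i₀}ᶜ = g '' {i₀}ᶜ := image_congr fun i hi => update_of_ne hi p g
  rwa [update_self, himage]

theorem norm_ιMulti_update_of_orthogonal [FiniteDimensional ℝ V] {g : Fin k → V}
    (hg : Pairwise fun i j => inner ℝ (g i) (g j) = 0) {i₀ : Fin k} {x : V}
    (hx : ∀ i ≠ i₀, inner ℝ (g i) x = 0) :
    ‖ιMulti ℝ k (update g i₀ x)‖ = ‖x‖ * ∏ i ∈ Finset.univ.erase i₀, ‖g i‖ := by
  rw [norm_ιMulti_of_orthogonal, ← Finset.mul_prod_erase _ _ (Finset.mem_univ i₀), update_self]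
  · congr 1
    exact Finset.prod_congr rfl fun i hi => by rw [update_of_ne (Finset.ne_of_mem_erase hi)]
  · intro i j hij
    rcases eq_or_ne i i₀ with rfl | hi
    · rw [update_self, update_of_ne hij.symm, real_inner_comm]
      exact hx j hij.symm
    · rcases eq_or_ne j i₀ with rfl | hj
      · rw [update_self, update_of_ne hi]
        exact hx i hi
      · rw [update_of_ne hi, update_of_ne hj]
        exact hg hij

end OrthogonalSystems

section Domination

theorem prod_le_pow_mul_prod {ι : Type*} [DecidableEq ι] {τ : ι → ℝ} (hτ : ∀ i, 0 ≤ τ i)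
    {α β : ℝ} {s t : Finset ι} (hst : s.card = t.card)
    (hα : ∀ i ∈ s \ t, τ i ≤ α) (hβ : ∀ i ∈ t \ s, 1 ≤ τ i * β) :
    ∏ i ∈ s, τ i ≤ (α * β) ^ (s \ t).card * ∏ i ∈ t, τ i := by
  have hprod : ∀ u : Finset ι, 0 ≤ ∏ i ∈ u, τ i := fun u => Finset.prod_nonneg fun i _ => hτ i
  have hsdiff : ∏ i ∈ s \ t, τ i ≤ α ^ (s \ t).card :=
    (Finset.prod_le_prod (fun i _ => hτ i) hα).trans_eq (Finset.prod_const α)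
  have hpow : 0 ≤ α ^ (s \ t).card := (hprod _).trans hsdiff
  have hone : 1 ≤ (∏ i ∈ t \ s, τ i) * β ^ (s \ t).card := by
    rw [Finset.card_sdiff_comm hst, ← Finset.prod_const, ← Finset.prod_mul_distrib]
    exact Finset.one_le_prod hβ
  calc ∏ i ∈ s, τ i = (∏ i ∈ s ∩ t, τ i) * ∏ i ∈ s \ t, τ i :=
        (Finset.prod_inter_mul_prod_sdiff s t τ).symm
    _ ≤ (∏ i ∈ s ∩ t, τ i) * (α ^ (s \ t).card * ((∏ i ∈ t \ s, τ i) * β ^ (s \ t).card)) :=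
        mul_le_mul_of_nonneg_left (hsdiff.trans (le_mul_of_one_le_right hpow hone)) (hprod _)
    _ = (α * β) ^ (s \ t).card * ((∏ i ∈ t ∩ s, τ i) * ∏ i ∈ t \ s, τ i) := by
        rw [mul_pow, Finset.inter_comm s t]
        ring
    _ = (α * β) ^ (s \ t).card * ∏ i ∈ t, τ i := by
        rw [Finset.prod_inter_mul_prod_sdiff t s τ]

theorem pow_le_mul_max_one_pow {x : ℝ} (hx : 0 ≤ x) {m k : ℕ} (hm : m ≠ 0) (hmk : m ≤ k) :
    x ^ m ≤ x * max 1 x ^ (k - 1) := by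
  rw [← mul_pow_sub_one hm]
  gcongr
  calc x ^ (m - 1) ≤ max 1 x ^ (m - 1) := by gcongr; exact le_max_right 1 x
    _ ≤ max 1 x ^ (k - 1) := pow_le_pow_right₀ (le_max_left 1 x) (by omega)

variable {V W Z : Type*}
  [NormedAddCommGroup V] [InnerProductSpace ℝ V] [FiniteDimensional ℝ V]
  [NormedAddCommGroup W] [InnerProductSpace ℝ W] [FiniteDimensional ℝ W]
  [NormedAddCommGroup Z] [InnerProductSpace ℝ Z]
  {T : V →ₗ[ℝ] W} {S : W →ₗ[ℝ] Z} {E F : Submodule ℝ V} {k : ℕ} {c : ℝ}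

theorem norm_map_ιMulti_family_basisOfIsCompl_le {ι : Type*} [Fintype ι] [LinearOrder ι]
    (hEF : IsCompl E F) (e : OrthonormalBasis ι ℝ E) (f : OrthonormalBasis (Fin k) ℝ F)
    (hf : Pairwise fun i j => inner ℝ (T (f i)) (T (f j)) = 0)
    (hST : ∀ v ∈ F, ‖S (T v)‖ = ‖v‖) {ρ : ℝ}
    (hρ : restrictNorm T E * restrictNorm S (F.map T) ≤ ρ)
    (s : powersetCard (ι ⊕ₗ Fin k) k) (hs : ∃ i ∈ s, i ∈ range Sum.inlₗ) :
    ‖exteriorPower.map k T (ιMulti_family ℝ k (basisOfIsCompl hEF e.toBasis f.toBasis) s)‖ ≤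
      √k.factorial * (ρ * max 1 ρ ^ (k - 1) * absDetOn T F) := by
  set b := basisOfIsCompl hEF e.toBasis f.toBasis
  set t : Finset (ι ⊕ₗ Fin k) := Finset.univ.image Sum.inrₗ
  have hinj : Injective (Sum.inrₗ : Fin k → ι ⊕ₗ Fin k) := Sum.inr_injective
  have ht : t.card = k := by simp [t, Finset.card_image_of_injective _ hinj]
  have hmem : ∀ i, i ∈ t ↔ i ∉ range Sum.inlₗ := fun i => by
    simpa [t, eq_comm] using (Set.ext_iff.mp compl_range_inlₗ i).symm
  have hE : ∀ i ∈ (s : Finset (ι ⊕ₗ Fin k)) \ t, ‖T (b i)‖ ≤ restrictNorm T E := fun i hi => by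
    obtain ⟨j, rfl⟩ := not_not.mp fun h => (Finset.mem_sdiff.mp hi).2 ((hmem i).mpr h)
    have h := norm_apply_le_restrictNorm_mul (T := T) (e j).2
    rwa [norm_coe, e.norm_eq_one, mul_one, ← e.coe_toBasis,
      ← basisOfIsCompl_inl hEF e.toBasis f.toBasis] at h
  have hF : ∀ i ∈ t \ s, 1 ≤ ‖T (b i)‖ * restrictNorm S (F.map T) := fun i hi => by
    obtain ⟨j, -, rfl⟩ := Finset.mem_image.mp (Finset.mem_sdiff.mp hi).1
    have h := norm_apply_le_restrictNorm_mul (T := S) (mem_map_of_mem (f := T) (f j).2)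
    rwa [hST _ (f j).2, norm_coe, f.norm_eq_one, mul_comm, ← f.coe_toBasis,
      ← basisOfIsCompl_inr hEF e.toBasis] at h
  have hdiff : ((s : Finset (ι ⊕ₗ Fin k)) \ t).card ≠ 0 := by
    obtain ⟨i, his, hi⟩ := hs
    exact Finset.card_ne_zero_of_mem
      (Finset.mem_sdiff.mpr ⟨his, fun hit => (hmem i).mp hit hi⟩)
  have hprod : ∏ i ∈ t, ‖T (b i)‖ = absDetOn T F := by
    rw [absDetOn_eq_prod_norm f hf, Finset.prod_image hinj.injOn]
    simp only [b, basisOfIsCompl_inr, OrthonormalBasis.coe_toBasis]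
  have hρ₀ : 0 ≤ restrictNorm T E * restrictNorm S (F.map T) :=
    mul_nonneg (restrictNorm_nonneg _ _) (restrictNorm_nonneg _ _)
  rw [map_apply_ιMulti_family, ← hprod]
  refine (norm_ιMulti_family_le _ _).trans (mul_le_mul_of_nonneg_left ?_ (Real.sqrt_nonneg _))
  refine (prod_le_pow_mul_prod (fun _ => norm_nonneg _) (s.2.trans ht.symm) hE hF).trans ?_
  refine mul_le_mul_of_nonneg_right ?_ (Finset.prod_nonneg fun _ _ => norm_nonneg _)
  exact (pow_le_pow_left₀ hρ₀ hρ _).trans <| pow_le_mul_max_one_pow (hρ₀.trans hρ) hdiff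
    ((Finset.card_le_card Finset.sdiff_subset).trans_eq s.2)

theorem restrictNorm_mixedSub_mul_wedgeSub_le [FiniteDimensional ℝ Z] (hEF : IsCompl E F)
    (hc₀ : 0 ≤ c) (hc : HasAngleBound c E F) (hF : finrank ℝ F = k)
    (hST : ∀ v ∈ F, ‖S (T v)‖ = ‖v‖) {ρ : ℝ}
    (hρ : restrictNorm T E * restrictNorm S (F.map T) ≤ ρ) :
    restrictNorm (exteriorPower.map k T) (mixedSub k E F) *
        restrictNorm (exteriorPower.map k S) (wedgeSub k (F.map T)) ≤
      (finrank ℝ V).choose k ^ 2 * (k.factorial * (1 + c) ^ k) *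
        (√k.factorial * (ρ * max 1 ρ ^ (k - 1))) := by
  obtain ⟨f, hf⟩ := exists_orthonormalBasis_orthogonal_image T hF
  set e := stdOrthonormalBasis ℝ E
  have hρ₀ : 0 ≤ ρ := (mul_nonneg (restrictNorm_nonneg _ _) (restrictNorm_nonneg _ _)).trans hρ
  have hdet : 0 ≤ absDetOn T F := Real.sqrt_nonneg _
  have hmixed := restrictNorm_span_ιMulti_family_le (basisOfIsCompl hEF e.toBasis f.toBasis)
    (exteriorPower.map k T) {s | ∃ i ∈ s, i ∈ range Sum.inlₗ}
    (D := √k.factorial * (ρ * max 1 ρ ^ (k - 1) * absDetOn T F)) (by positivity) (by positivity)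
    (hc.abs_coord_basisOfIsCompl_le hEF e f)
    (norm_map_ιMulti_family_basisOfIsCompl_le hEF e f hf hST hρ)
  rw [← mixedSub_eq_span_basisOfIsCompl] at hmixed
  refine (mul_le_mul_of_nonneg_right hmixed (restrictNorm_nonneg _ _)).trans_eq ?_
  linear_combination (finrank ℝ V).choose k ^ 2 * (k.factorial * (1 + c) ^ k) *
    (√k.factorial * (ρ * max 1 ρ ^ (k - 1))) * restrictNorm_wedgeSub_mul_absDetOn hF hST

theorem HasAngleBound.norm_mul_prod_erase_le (hc : HasAngleBound c E F) {g : Fin k → V}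
    (hgF : ∀ i, g i ∈ F) (hg : Pairwise fun i j => inner ℝ (g i) (g j) = 0) (i₀ : Fin k) {x : V}
    (hx : x ∈ E) :
    ‖x‖ * ∏ i ∈ Finset.univ.erase i₀, ‖g i‖ ≤ c * ‖ιMulti ℝ k (update g i₀ x)‖ := by
  -- Removing from `x` its component along the other factors leaves the wedge unchanged, makes its
  -- norm a product, and by the angle bound shortens `x` at most by a factor `c`.
  set P := span ℝ (g '' {i₀}ᶜ)
  have hp : P.starProjection x ∈ P := P.starProjection_apply_mem x
  have hPF : P ≤ F := span_le.mpr (image_subset_iff.mpr fun i _ => hgF i)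
  have horth : ∀ i ≠ i₀, inner ℝ (g i) (x - P.starProjection x) = 0 := fun i hi =>
    P.sub_starProjection_mem_orthogonal x _ (subset_span (mem_image_of_mem g hi))
  rw [← ιMulti_update_sub_of_mem_span g x hp, norm_ιMulti_update_of_orthogonal hg horth,
    ← mul_assoc, sub_eq_add_neg]
  gcongr
  exact hc x hx _ (F.neg_mem (hPF hp))

theorem norm_map_mul_prod_erase_le (f : OrthonormalBasis (Fin k) ℝ F)
    (hf : Pairwise fun i j => inner ℝ (T (f i)) (T (f j)) = 0) (hc₀ : 0 ≤ c)
    (hc : HasAngleBound c (E.map T) (F.map T)) (i₀ : Fin k) {e : V} (he : e ∈ E) :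
    ‖T e‖ * ∏ i ∈ Finset.univ.erase i₀, ‖T (f i)‖ ≤
      c * (restrictNorm (exteriorPower.map k T) (mixedSub k E F) * (√k.factorial * ‖e‖)) := by
  set g : Fin k → V := update (fun i => (f i : V)) i₀ e
  have hg₀ : g i₀ = e := update_self ..
  have hgf : ∀ i ≠ i₀, g i = f i := fun i hi => update_of_ne hi ..
  have hmem : ιMulti ℝ k g ∈ mixedSub k E F := by
    refine ιMulti_mem_mixedSub (i₀ := i₀) (fun i => ?_) (hg₀ ▸ he)
    rcases eq_or_ne i i₀ with rfl | hi
    exacts [.inl (hg₀ ▸ he), .inr (hgf i hi ▸ (f i).2)]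
  have hnorm : ‖ιMulti ℝ k g‖ ≤ √k.factorial * ‖e‖ := by
    refine (norm_ιMulti_le g).trans_eq ?_
    rw [← Finset.mul_prod_erase _ _ (Finset.mem_univ i₀), hg₀, Finset.prod_eq_one, mul_one]
    intro i hi
    rw [hgf i (Finset.ne_of_mem_erase hi), norm_coe, f.norm_eq_one]
  calc ‖T e‖ * ∏ i ∈ Finset.univ.erase i₀, ‖T (f i)‖
      ≤ c * ‖ιMulti ℝ k (update (fun i => T (f i)) i₀ (T e))‖ :=
        hc.norm_mul_prod_erase_le (fun i => mem_map_of_mem (f i).2) hf i₀ (mem_map_of_mem he)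
    _ = c * ‖exteriorPower.map k T (ιMulti ℝ k g)‖ := by
        rw [map_apply_ιMulti, comp_update]
        rfl
    _ ≤ _ := by
        gcongr
        refine (norm_apply_le_restrictNorm_mul hmem).trans ?_
        gcongr
        exact restrictNorm_nonneg _ _

theorem restrictNorm_mul_restrictNorm_le [FiniteDimensional ℝ Z] (hc₀ : 0 ≤ c)
    (hc : HasAngleBound c (E.map T) (F.map T)) (hk : k ≠ 0) (hF : finrank ℝ F = k)
    (hST : ∀ v ∈ F, ‖S (T v)‖ = ‖v‖) :
    restrictNorm T E * restrictNorm S (F.map T) ≤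
      c * √k.factorial * (restrictNorm (exteriorPower.map k T) (mixedSub k E F) *
        restrictNorm (exteriorPower.map k S) (wedgeSub k (F.map T))) := by
  obtain ⟨f, hf⟩ := exists_orthonormalBasis_orthogonal_image T hF
  have : NeZero k := ⟨hk⟩
  obtain ⟨i₀, hi₀⟩ := Finite.exists_min fun i => ‖T (f i)‖
  set A := restrictNorm (exteriorPower.map k T) (mixedSub k E F)
  set B := restrictNorm (exteriorPower.map k S) (wedgeSub k (F.map T))
  set σ := ‖T (f i₀)‖
  set P := ∏ i ∈ Finset.univ.erase i₀, ‖T (f i)‖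
  have hA : 0 ≤ A := restrictNorm_nonneg _ _
  have hdet : B * (σ * P) = 1 := by
    rw [Finset.mul_prod_erase _ (fun i => ‖T (f i)‖) (Finset.mem_univ i₀),
      ← absDetOn_eq_prod_norm f hf, restrictNorm_wedgeSub_mul_absDetOn hF hST]
  have hσ : 0 < σ := (norm_nonneg _).lt_of_ne fun h => by simp [σ, ← h] at hdet
  have hP : 0 < P := (Finset.prod_nonneg fun _ _ => norm_nonneg _).lt_of_ne fun h => by
    simp [P, ← h] at hdet
  have hS : restrictNorm S (F.map T) ≤ σ⁻¹ := by
    refine restrictNorm_le (by positivity) ?_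
    rintro _ ⟨v, hv, rfl⟩
    rw [hST v hv, ← div_eq_inv_mul, le_div_iff₀ hσ, mul_comm]
    exact mul_norm_le_norm_map_of_orthogonal f hf hσ.le hi₀ hv
  have hT : restrictNorm T E ≤ c * (A * √k.factorial) * P⁻¹ := by
    refine restrictNorm_le (by positivity) fun e he => ?_
    have h := norm_map_mul_prod_erase_le f hf hc₀ hc i₀ he
    rw [← le_div_iff₀ hP] at h
    exact h.trans_eq (by ring)
  calc restrictNorm T E * restrictNorm S (F.map T) ≤ c * (A * √k.factorial) * P⁻¹ * σ⁻¹ :=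
        mul_le_mul hT hS (restrictNorm_nonneg _ _) (by positivity)
    _ = c * (A * √k.factorial) * (B * (σ * P)) * P⁻¹ * σ⁻¹ := by rw [hdet, mul_one]
    _ = c * √k.factorial * (A * B) := by field_simp

end Domination

section ExteriorPowerCocycle

variable {M : Type*} {G : M → Type*} [∀ x, NormedAddCommGroup (G x)]
  [∀ x, InnerProductSpace ℝ (G x)] [∀ x, FiniteDimensional ℝ (G x)] {φ : ℝ → M → M}
  {A : ∀ (t : ℝ) (x : M), G x →ₗ[ℝ] G (φ t x)} {Γ : Set M} {E F : ∀ x, Submodule ℝ (G x)} {k : ℕ}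

theorem volumeExpanding_iff_uniformlyExpanded_wedge (hF : ∀ x ∈ Γ, finrank ℝ (F x) = k)
    (hmap : ∀ x ∈ Γ, ∀ t, (F x).map (A t x) = F (φ t x))
    (hzero : ∀ x ∈ Γ, ∀ v ∈ F x, ‖A 0 x v‖ = ‖v‖)
    (hneg : ∀ x ∈ Γ, ∀ t, 0 ≤ t → ∀ v ∈ F x, ‖A (-t) (φ t x) (A t x v)‖ = ‖v‖) :
    VolumeExpanding φ A Γ F ↔
      UniformlyExpanded φ (fun t x => exteriorPower.map k (A t x)) Γ
        fun x => wedgeSub k (F x) := by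
  have hinv : ∀ x ∈ Γ, ∀ t, 0 ≤ t →
      restrictNorm (exteriorPower.map k (A (-t) (φ t x))) (wedgeSub k (F (φ t x))) =
        (absDetOn (A t x) (F x))⁻¹ := fun x hx t ht => by
    rw [← hmap x hx]
    exact eq_inv_of_mul_eq_one_left
      (restrictNorm_wedgeSub_mul_absDetOn (hF x hx) (hneg x hx t ht))
  constructor
  · rintro ⟨C, hC, lam, hlam, hvol⟩
    refine ⟨max C⁻¹ 1, by positivity, lam, hlam, fun x hx t ht => ?_⟩
    rw [hinv x hx t ht]
    rcases ht.eq_or_lt with rfl | ht₀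
    · simp [absDetOn_eq_one (hzero x hx)]
    · calc (absDetOn (A t x) (F x))⁻¹ ≤ (C * Real.exp (lam * t))⁻¹ :=
            inv_anti₀ (by positivity) (hvol x hx t ht₀).le
        _ = C⁻¹ * Real.exp (-lam * t) := by rw [mul_inv, ← Real.exp_neg, neg_mul]
        _ ≤ max C⁻¹ 1 * Real.exp (-lam * t) := by gcongr; exact le_max_left _ _
  · rintro ⟨C, hC, lam, hlam, hexp⟩
    refine ⟨(C + 1)⁻¹, by positivity, lam, hlam, fun x hx t ht => ?_⟩
    have hle := hexp x hx t ht.le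
    rw [hinv x hx t ht.le] at hle
    have hdet : 0 < absDetOn (A t x) (F x) := by
      refine (Real.sqrt_nonneg _).lt_of_ne' fun h => ?_
      have := restrictNorm_wedgeSub_mul_absDetOn (hF x hx) (hneg x hx t ht.le)
      simp [show absDetOn (A t x) (F x) = 0 from h] at this
    calc (C + 1)⁻¹ * Real.exp (lam * t) = ((C + 1) * Real.exp (-lam * t))⁻¹ := by
          rw [mul_inv, ← Real.exp_neg, neg_mul, neg_neg]
      _ < absDetOn (A t x) (F x) := by
          rw [inv_lt_comm₀ (by positivity) hdet]
          exact hle.trans_lt (by gcongr; exact lt_add_one C)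

variable [TopologicalSpace M] {IsCont : Set M → (∀ x, G x) → Prop}
  {IsContWedge : Set M → (∀ x, ⋀[ℝ]^k (G x)) → Prop} {c : ℝ}

theorem IsDominatedSplitting.wedge (h : IsDominatedSplitting IsCont φ A Γ E F)
    (hwedge : IsInvariantSplitting IsContWedge φ (fun t x => exteriorPower.map k (A t x)) Γ
      (fun x => mixedSub k (E x) (F x)) fun x => wedgeSub k (F x))
    {n : ℕ} (hn : ∀ x ∈ Γ, finrank ℝ (G x) = n) (hk : k ≠ 0)
    (hF : ∀ x ∈ Γ, finrank ℝ (F x) = k) (hc₀ : 0 ≤ c)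
    (hc : ∀ x ∈ Γ, HasAngleBound c (E x) (F x))
    (hneg : ∀ x ∈ Γ, ∀ t, 0 ≤ t → ∀ v ∈ F x, ‖A (-t) (φ t x) (A t x v)‖ = ‖v‖) :
    IsDominatedSplitting IsContWedge φ (fun t x => exteriorPower.map k (A t x)) Γ
      (fun x => mixedSub k (E x) (F x)) fun x => wedgeSub k (F x) := by
  obtain ⟨K, hK, lam, hlam, hdom⟩ := h.dominated
  refine ⟨hwedge, fun x hx => ?_, fun x hx => wedgeSub_ne_bot (hF x hx), ?_⟩
  · exact (mixedSub_ne_bot_iff (h.isCompl x hx) hk (hF x hx)).mpr (h.left_ne_bot x hx)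
  set B : ℝ := n.choose k ^ 2 * (k.factorial * (1 + c) ^ k)
  refine ⟨B * (√k.factorial * (K * max 1 K ^ (k - 1))) + 1, by positivity, lam, hlam,
    fun x hx t ht => ?_⟩
  set ρ := K * Real.exp (-lam * t) with hρ
  have hρK : ρ ≤ K :=
    mul_le_of_le_one_right hK.le (Real.exp_le_one_iff.mpr (by nlinarith))
  have hle := restrictNorm_mixedSub_mul_wedgeSub_le (ρ := ρ) (h.isCompl x hx) hc₀ (hc x hx)
    (hF x hx) (hneg x hx t ht.le) (by rw [h.map_right x hx]; exact (hdom x hx t ht).le)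
  rw [h.map_right x hx, hn x hx] at hle
  calc _ ≤ B * (√k.factorial * (ρ * max 1 ρ ^ (k - 1))) := hle
    _ ≤ B * (√k.factorial * (ρ * max 1 K ^ (k - 1))) := by gcongr
    _ = B * (√k.factorial * (K * max 1 K ^ (k - 1))) * Real.exp (-lam * t) := by rw [hρ]; ring
    _ < _ := by gcongr; exact lt_add_one _

theorem IsDominatedSplitting.of_wedge
    (h : IsDominatedSplitting IsContWedge φ (fun t x => exteriorPower.map k (A t x)) Γ
      (fun x => mixedSub k (E x) (F x)) fun x => wedgeSub k (F x))
    (hEF : IsInvariantSplitting IsCont φ A Γ E F) (hk : k ≠ 0)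
    (hF : ∀ x ∈ Γ, finrank ℝ (F x) = k) (hΓφ : ∀ t, MapsTo (φ t) Γ Γ) (hc₀ : 0 ≤ c)
    (hc : ∀ x ∈ Γ, HasAngleBound c (E x) (F x))
    (hneg : ∀ x ∈ Γ, ∀ t, 0 ≤ t → ∀ v ∈ F x, ‖A (-t) (φ t x) (A t x v)‖ = ‖v‖) :
    IsDominatedSplitting IsCont φ A Γ E F := by
  obtain ⟨K, hK, lam, hlam, hdom⟩ := h.dominated
  refine ⟨hEF, fun x hx => ?_, fun x hx hbot => hk ?_, c * √k.factorial * K + 1, by positivity,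
    lam, hlam, fun x hx t ht => ?_⟩
  · exact (mixedSub_ne_bot_iff (hEF.isCompl x hx) hk (hF x hx)).mp (h.left_ne_bot x hx)
  · rw [← hF x hx, hbot, finrank_bot]
  have hcφ : HasAngleBound c ((E x).map (A t x)) ((F x).map (A t x)) := by
    rw [hEF.map_left x hx, hEF.map_right x hx]
    exact hc _ (hΓφ t hx)
  have hle := restrictNorm_mul_restrictNorm_le hc₀ hcφ hk (hF x hx) (hneg x hx t ht.le)
  rw [hEF.map_right x hx] at hle
  calc _ ≤ c * √k.factorial * (K * Real.exp (-lam * t)) :=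
        hle.trans (mul_le_mul_of_nonneg_left (hdom x hx t ht).le (by positivity))
    _ = c * √k.factorial * K * Real.exp (-lam * t) := by ring
    _ < _ := by gcongr; exact lt_add_one _

end ExteriorPowerCocycle

section AngleBoundNearby

theorem exists_coeff_of_mem_span_image {V : Type*} [AddCommGroup V] [Module ℝ V] {ι : Type*}
    [Fintype ι] {w : ι → V} {J : Set ι} {v : V} (hv : v ∈ span ℝ (w '' J)) :
    ∃ a : ι → ℝ, (∀ i ∉ J, a i = 0) ∧ ∑ i, a i • w i = v := by
  obtain ⟨a, ha, rfl⟩ := (Finsupp.mem_span_image_iff_linearCombination ℝ).mp hv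
  refine ⟨a, fun i hi => (Finsupp.mem_supported' ℝ a).mp ha i hi, ?_⟩
  rw [Finsupp.linearCombination_apply, Finsupp.sum_fintype _ _ fun i => zero_smul ℝ (w i)]

theorem norm_le_norm_add_of_disjoint_support {ι : Type*} [Fintype ι] {J : Set ι} {a b : ι → ℝ}
    (ha : ∀ i ∉ J, a i = 0) (hb : ∀ i ∈ J, b i = 0) : ‖a‖ ≤ ‖a + b‖ := by
  refine (pi_norm_le_iff_of_nonneg (norm_nonneg _)).mpr fun i => ?_
  by_cases hi : i ∈ J
  · simpa [hb i hi] using norm_le_pi_norm (a + b) i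
  · simp [ha i hi]

variable {V W : Type*} [NormedAddCommGroup V] [NormedSpace ℝ V] [NormedAddCommGroup W]
  [NormedSpace ℝ W] {X : Type*} {l : Filter X}

theorem eventually_norm_le_of_tendsto {T : X → V →L[ℝ] W} {T₀ : V →L[ℝ] W}
    (hT : Filter.Tendsto T l (𝓝 T₀)) {K : ℝ} (hK : 0 < K) (hT₀ : ∀ v, ‖v‖ ≤ K * ‖T₀ v‖) :
    ∀ᶠ x in l, ∀ v, ‖v‖ ≤ 2 * K * ‖T x v‖ := by
  have hnear : ∀ᶠ x in l, ‖T₀ - T x‖ < (2 * K)⁻¹ := by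
    have hlim : Filter.Tendsto (fun x => ‖T₀ - T x‖) l (𝓝 0) := by
      simpa only [sub_self, norm_zero] using (hT.const_sub T₀).norm
    exact hlim.eventually_lt_const (by positivity)
  filter_upwards [hnear] with x hx v
  have hdiff : ‖T₀ v‖ ≤ ‖T x v‖ + (2 * K)⁻¹ * ‖v‖ := by
    calc ‖T₀ v‖ = ‖T x v + (T₀ - T x) v‖ := by simp
      _ ≤ ‖T x v‖ + ‖(T₀ - T x) v‖ := norm_add_le _ _
      _ ≤ ‖T x v‖ + (2 * K)⁻¹ * ‖v‖ := by grw [(T₀ - T x).le_of_opNorm_le hx.le v]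
  have hhalf : ‖v‖ ≤ K * ‖T x v‖ + ‖v‖ / 2 := by
    calc ‖v‖ ≤ K * (‖T x v‖ + (2 * K)⁻¹ * ‖v‖) := by grw [← hdiff]; exact hT₀ v
      _ = K * ‖T x v‖ + ‖v‖ / 2 := by field_simp
  linarith

theorem hasAngleBound_span_image {ι : Type*} [Fintype ι] {w : ι → V} {C R : ℝ} (hR₀ : 0 ≤ R)
    (hC : ∀ a : ι → ℝ, ‖a‖ ≤ C * ‖∑ i, a i • w i‖)
    (hR : ∀ a : ι → ℝ, ‖∑ i, a i • w i‖ ≤ R * ‖a‖) (J : Set ι) :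
    HasAngleBound (R * C) (span ℝ (w '' J)) (span ℝ (w '' Jᶜ)) := by
  intro e he f hf
  obtain ⟨a, ha, rfl⟩ := exists_coeff_of_mem_span_image he
  obtain ⟨b, hb, rfl⟩ := exists_coeff_of_mem_span_image hf
  have hab : ‖a‖ ≤ ‖a + b‖ :=
    norm_le_norm_add_of_disjoint_support ha fun i hi => hb i (notMem_compl_iff.mpr hi)
  have hsum : ∑ i, a i • w i + ∑ i, b i • w i = ∑ i, (a + b) i • w i := by
    simp only [Pi.add_apply, add_smul, Finset.sum_add_distrib]
  calc ‖∑ i, a i • w i‖ ≤ R * ‖a + b‖ := (hR a).trans (by gcongr)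
    _ ≤ R * (C * ‖∑ i, (a + b) i • w i‖) := by gcongr; exact hC (a + b)
    _ = R * C * ‖∑ i, a i • w i + ∑ i, b i • w i‖ := by rw [hsum, mul_assoc]

theorem exists_eventually_hasAngleBound_span {ι : Type*} [Finite ι] {u : X → ι → V} {u₀ : ι → V}
    (hu : Filter.Tendsto u l (𝓝 u₀)) (hu₀ : LinearIndependent ℝ u₀) (J : Set ι) :
    ∃ c, 0 ≤ c ∧ ∀ᶠ x in l, HasAngleBound c (span ℝ (u x '' J)) (span ℝ (u x '' Jᶜ)) := by
  classical
  have := Fintype.ofFinite ι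
  let T : (ι → V) ≃L[ℝ] (ι → ℝ) →L[ℝ] V := (ContinuousLinearEquiv.piRing ι).symm
  have hTapply (w : ι → V) (a : ι → ℝ) : T w a = ∑ i, a i • w i :=
    LinearEquiv.piRing_symm_apply ℝ w a
  have hT : Filter.Tendsto (fun x => T (u x)) l (𝓝 (T u₀)) := (T.continuous.tendsto _).comp hu
  have hker : (T u₀ : (ι → ℝ) →ₗ[ℝ] V).ker = ⊥ := by
    refine LinearMap.ker_eq_bot'.mpr fun a ha => funext ?_
    exact Fintype.linearIndependent_iff.mp hu₀ a ((hTapply _ _).symm.trans ha)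
  obtain ⟨K, hK, hanti⟩ := LinearMap.exists_antilipschitzWith _ hker
  refine ⟨(‖T u₀‖ + 1) * (2 * K), by positivity, ?_⟩
  filter_upwards [eventually_norm_le_of_tendsto hT (NNReal.coe_pos.mpr hK)
      (hanti.le_mul_norm (map_zero _)), hT.norm.eventually_lt_const (lt_add_one _)] with x hlow hup
  refine hasAngleBound_span_image (by positivity) (fun a => ?_) (fun a => ?_) J
  · rw [← hTapply]
    exact hlow a
  · rw [← hTapply]
    exact (T (u x)).le_of_opNorm_le hup.le a

end AngleBoundNearby

namespace HasAngleBound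

variable {V W : Type*} [NormedAddCommGroup V] [NormedSpace ℝ V] [NormedAddCommGroup W]
  [NormedSpace ℝ W] {c c' : ℝ} {E F : Submodule ℝ V}

theorem mono (h : HasAngleBound c E F) (hc : c ≤ c') : HasAngleBound c' E F :=
  fun e he f hf => by grw [h e he f hf, hc]

theorem of_map {T : V →ₗ[ℝ] W} (h : HasAngleBound c (E.map T) (F.map T)) (hc : 0 ≤ c) {a b : ℝ}
    (hb₀ : 0 ≤ b) (ha : ∀ v, ‖T v‖ ≤ a * ‖v‖) (hb : ∀ v, ‖v‖ ≤ b * ‖T v‖) :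
    HasAngleBound (b * c * a) E F := fun e he f hf => by
  calc ‖e‖ ≤ b * (c * ‖T e + T f‖) := by
        grw [← h _ (mem_map_of_mem he) _ (mem_map_of_mem hf)]
        exact hb e
    _ ≤ b * (c * (a * ‖e + f‖)) := by
        grw [← map_add, ha]
    _ = b * c * a * ‖e + f‖ := by ring

end HasAngleBound

section Subbundle

theorem continuous_comp_ιMulti {V : Type*} [NormedAddCommGroup V] [NormedSpace ℝ V]
    [FiniteDimensional ℝ V] {k : ℕ} (ℓ : ⋀[ℝ]^k V →ₗ[ℝ] ℝ) :
    Continuous fun v : Fin k → V => ℓ (ιMulti ℝ k v) := by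
  let b := finBasis ℝ V
  have hexpand (v : Fin k → V) : ℓ (ιMulti ℝ k v) =
      ∑ s, (Matrix.of fun i j => b.coord (powersetCard.ofFinEmbEquiv.symm s j) (v i)).det *
        ℓ (b.exteriorPower k s) := by
    conv_lhs => rw [← (b.exteriorPower k).sum_repr (ιMulti ℝ k v)]
    simp [basis_repr_apply]
  simp only [hexpand]
  refine continuous_finsetSum _ fun s _ => .mul (.matrix_det ?_) continuous_const
  exact continuous_matrix fun i j =>
    (b.coord _).continuous_of_finiteDimensional.comp (continuous_apply i)

variable {V : Type*} [NormedAddCommGroup V] [NormedSpace ℝ V]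
  {H : Type*} [TopologicalSpace H] {I : ModelWithCorners ℝ V H}
  {M : Type*} [TopologicalSpace M] [ChartedSpace H M]

theorem IsContSubbundle.of_finite_frame {G : M → Type*} [∀ x, AddCommGroup (G x)]
    [∀ x, Module ℝ (G x)] {IsCont : Set M → (∀ x, G x) → Prop} {Γ : Set M}
    {S : ∀ x, Submodule ℝ (G x)}
    (h : ∀ x₀ ∈ Γ, ∃ U ∈ 𝓝 x₀, ∃ (κ : Type) (_ : Finite κ) (s : κ → ∀ x, G x),
      (∀ i, IsCont (U ∩ Γ) (s i)) ∧
      ∀ x ∈ U ∩ Γ, LinearIndependent ℝ (fun i => s i x) ∧ span ℝ (range fun i => s i x) = S x) :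
    IsContSubbundle IsCont Γ S := fun x₀ hx₀ => by
  obtain ⟨U, hU, κ, _, s, hs, hframe⟩ := h x₀ hx₀
  let q := (Finite.equivFin κ).symm
  refine ⟨U, hU, Nat.card κ, s ∘ q, fun i => hs (q i), fun x hx => ?_⟩
  obtain ⟨hli, hspan⟩ := hframe x hx
  refine ⟨hli.comp q q.injective, ?_⟩
  rw [← hspan, ← q.surjective.range_comp fun i => s i x]
  rfl

variable [IsManifold I 1 M]

namespace IsContVectorField

variable {W W' : Set M}

theorem mono {s : ∀ x : M, TangentSpace I x} (hs : IsContVectorField I W s) (h : W' ⊆ W) :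
    IsContVectorField I W' s :=
  ContinuousOn.mono hs h

theorem continuousWithinAt_linearMapAt {s : ∀ x : M, TangentSpace I x}
    (hs : IsContVectorField I W s) {x₀ : M} (hx₀ : x₀ ∈ W) :
    ContinuousWithinAt (fun x =>
      (trivializationAt V (fun y : M => TangentSpace I y) x₀).linearMapAt ℝ x (s x)) W x₀ := by
  set τ := trivializationAt V (fun y : M => TangentSpace I y) x₀
  have hmem : x₀ ∈ τ.baseSet := FiberBundle.mem_baseSet_trivializationAt' x₀
  have hcont := ((FiberBundle.continuousWithinAt_totalSpace V _).mp (hs x₀ hx₀)).2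
  refine hcont.congr_of_eventuallyEq ?_ (by rw [τ.coe_linearMapAt_of_mem hmem])
  filter_upwards [mem_nhdsWithin_of_mem_nhds (τ.open_baseSet.mem_nhds hmem)] with x hx
  rw [τ.coe_linearMapAt_of_mem hx]

theorem ιMulti [FiniteDimensional ℝ V] {k : ℕ} {v : Fin k → ∀ x : M, TangentSpace I x}
    (hv : ∀ i, IsContVectorField I W (v i)) :
    IsContMultivectorField I k W fun x => ιMulti ℝ k fun i => v i x := fun x₀ hx₀ ℓ => by
  simp only [map_apply_ιMulti]
  exact (continuous_comp_ιMulti ℓ).continuousAt.comp_continuousWithinAt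
    (continuousWithinAt_pi.mpr fun i => (hv i).continuousWithinAt_linearMapAt hx₀)

end IsContVectorField

variable {Γ : Set M} {E F : ∀ x : M, Submodule ℝ (TangentSpace I x)}

theorem exists_adapted_frame (hE : IsContSubbundle (IsContVectorField I) Γ E)
    (hF : IsContSubbundle (IsContVectorField I) Γ F) (hEF : ∀ x ∈ Γ, IsCompl (E x) (F x))
    {x₀ : M} (hx₀ : x₀ ∈ Γ) :
    ∃ U ∈ 𝓝 x₀, ∃ (m n : ℕ) (v : Fin m ⊕ₗ Fin n → ∀ x : M, TangentSpace I x),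
      (∀ i, IsContVectorField I (U ∩ Γ) (v i)) ∧
      ∀ x ∈ U ∩ Γ, ∃ b : Basis (Fin m ⊕ₗ Fin n) ℝ (TangentSpace I x),
        (⇑b = fun i => v i x) ∧ span ℝ (b '' range Sum.inlₗ) = E x ∧
          span ℝ (b '' (range Sum.inlₗ)ᶜ) = F x := by
  obtain ⟨U₁, hU₁, m, e, he, heE⟩ := hE x₀ hx₀
  obtain ⟨U₂, hU₂, n, f, hf, hfF⟩ := hF x₀ hx₀
  refine ⟨U₁ ∩ U₂, Filter.inter_mem hU₁ hU₂, m, n, Sum.elim e f ∘ ofLex, fun i => ?_, ?_⟩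
  · obtain ⟨i | i, rfl⟩ := toLex.surjective i
    · exact (he i).mono fun x hx => ⟨hx.1.1, hx.2⟩
    · exact (hf i).mono fun x hx => ⟨hx.1.2, hx.2⟩
  · rintro x ⟨⟨hx₁, hx₂⟩, hx⟩
    obtain ⟨heli, hespan⟩ := heE x ⟨hx₁, hx⟩
    obtain ⟨hfli, hfspan⟩ := hfF x ⟨hx₂, hx⟩
    let be : Basis (Fin m) ℝ (E x) := (Basis.span heli).map (.ofEq _ _ hespan)
    let bf : Basis (Fin n) ℝ (F x) := (Basis.span hfli).map (.ofEq _ _ hfspan)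
    refine ⟨basisOfIsCompl (hEF x hx) be bf, funext fun i => ?_, span_basisOfIsCompl_image_inl ..,
      span_basisOfIsCompl_image_compl_inl ..⟩
    obtain ⟨i | i, rfl⟩ := toLex.surjective i
    · exact (basisOfIsCompl_inl _ be bf i).trans (by simp [be, Basis.span_apply])
    · exact (basisOfIsCompl_inr _ be bf i).trans (by simp [bf, Basis.span_apply])

theorem IsContSubbundle.of_ιMulti_family [FiniteDimensional ℝ V] {k : ℕ}
    {S : ∀ x : M, Submodule ℝ (⋀[ℝ]^k (TangentSpace I x))}
    (h : ∀ x₀ ∈ Γ, ∃ U ∈ 𝓝 x₀, ∃ (ι : Type) (_ : LinearOrder ι) (_ : Finite ι)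
      (v : ι → ∀ x : M, TangentSpace I x) (A : Set (powersetCard ι k)),
      (∀ i, IsContVectorField I (U ∩ Γ) (v i)) ∧
      ∀ x ∈ U ∩ Γ, LinearIndependent ℝ (fun i => v i x) ∧
        span ℝ (ιMulti_family ℝ k (fun i => v i x) '' A) = S x) :
    IsContSubbundle (IsContMultivectorField I k) Γ S := .of_finite_frame fun x₀ hx₀ => by
  obtain ⟨U, hU, ι, _, _, v, A, hv, hframe⟩ := h x₀ hx₀
  refine ⟨U, hU, A, inferInstance, fun s x => ιMulti_family ℝ k (fun i => v i x) s,
    fun s => IsContVectorField.ιMulti fun i => hv _, fun x hx => ?_⟩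
  obtain ⟨hli, hspan⟩ := hframe x hx
  refine ⟨(ιMulti_family_linearIndependent_field k hli).comp _ Subtype.val_injective, ?_⟩
  rw [← hspan, image_eq_range]

theorem isContSubbundle_wedgeSub [FiniteDimensional ℝ V]
    (hE : IsContSubbundle (IsContVectorField I) Γ E)
    (hF : IsContSubbundle (IsContVectorField I) Γ F) (hEF : ∀ x ∈ Γ, IsCompl (E x) (F x))
    (k : ℕ) : IsContSubbundle (IsContMultivectorField I k) Γ fun x => wedgeSub k (F x) :=
  .of_ιMulti_family fun x₀ hx₀ => by
    obtain ⟨U, hU, m, n, v, hv, hframe⟩ := exists_adapted_frame hE hF hEF hx₀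
    refine ⟨U, hU, Fin m ⊕ₗ Fin n, inferInstance, inferInstance, v,
      {s | ∃ i ∈ s, i ∈ range Sum.inlₗ}ᶜ, hv, fun x hx => ?_⟩
    obtain ⟨b, hb, -, hbF⟩ := hframe x hx
    rw [← hb, ← hbF]
    exact ⟨b.linearIndependent, (wedgeSub_span_basis b _).symm⟩

theorem isContSubbundle_mixedSub [FiniteDimensional ℝ V]
    (hE : IsContSubbundle (IsContVectorField I) Γ E)
    (hF : IsContSubbundle (IsContVectorField I) Γ F) (hEF : ∀ x ∈ Γ, IsCompl (E x) (F x))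
    (k : ℕ) : IsContSubbundle (IsContMultivectorField I k) Γ fun x => mixedSub k (E x) (F x) :=
  .of_ιMulti_family fun x₀ hx₀ => by
    obtain ⟨U, hU, m, n, v, hv, hframe⟩ := exists_adapted_frame hE hF hEF hx₀
    refine ⟨U, hU, Fin m ⊕ₗ Fin n, inferInstance, inferInstance, v,
      {s | ∃ i ∈ s, i ∈ range Sum.inlₗ}, hv, fun x hx => ?_⟩
    obtain ⟨b, hb, hbE, hbF⟩ := hframe x hx
    rw [← hb, ← hbE, ← hbF]
    exact ⟨b.linearIndependent, (mixedSub_span_basis b _).symm⟩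

theorem IsInvariantSplitting.wedge [FiniteDimensional ℝ V] {φ : ℝ → M → M}
    (h : IsInvariantSplitting (IsContVectorField I) φ (derivCocycle I φ) Γ E F) (k : ℕ) :
    IsInvariantSplitting (IsContMultivectorField I k) φ (wedgeCocycle I k φ) Γ
      (fun x => mixedSub k (E x) (F x)) fun x => wedgeSub k (F x) where
  isCompl x hx := isCompl_mixedSub_wedgeSub (h.isCompl x hx) k
  continuous_left := isContSubbundle_mixedSub h.continuous_left h.continuous_right h.isCompl k
  continuous_right := isContSubbundle_wedgeSub h.continuous_left h.continuous_right h.isCompl k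
  map_left x hx t := by
    rw [← h.map_left x hx t, ← h.map_right x hx t]
    exact map_mixedSub ..
  map_right x hx t := by
    rw [← h.map_right x hx t]
    exact map_wedgeSub ..

section Angle

variable [RiemannianBundle (fun x : M => TangentSpace I x)]
  [IsContinuousRiemannianBundle V (fun x : M => TangentSpace I x)]

theorem exists_hasAngleBound_nhdsWithin
    (hE : IsContSubbundle (IsContVectorField I) Γ E)
    (hF : IsContSubbundle (IsContVectorField I) Γ F) (hEF : ∀ x ∈ Γ, IsCompl (E x) (F x))
    {x₀ : M} (hx₀ : x₀ ∈ Γ) :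
    ∃ c, 0 ≤ c ∧ ∀ᶠ x in 𝓝[Γ] x₀, HasAngleBound c (E x) (F x) := by
  obtain ⟨U, hU, m, n, v, hv, hframe⟩ := exists_adapted_frame hE hF hEF hx₀
  set τ := trivializationAt V (fun y : M => TangentSpace I y) x₀
  have hτ : ∀ᶠ x in 𝓝 x₀, x ∈ τ.baseSet :=
    τ.open_baseSet.mem_nhds (FiberBundle.mem_baseSet_trivializationAt' x₀)
  have hx₀U : x₀ ∈ U ∩ Γ := ⟨mem_of_mem_nhds hU, hx₀⟩
  have hlim : Filter.Tendsto (fun x i => τ.linearMapAt ℝ x (v i x)) (𝓝[U ∩ Γ] x₀)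
      (𝓝 fun i => τ.linearMapAt ℝ x₀ (v i x₀)) :=
    tendsto_pi_nhds.mpr fun i => (hv i).continuousWithinAt_linearMapAt hx₀U
  have hli : LinearIndependent ℝ fun i => τ.linearMapAt ℝ x₀ (v i x₀) := by
    obtain ⟨b, hb, -⟩ := hframe x₀ hx₀U
    rw [← comp_def (τ.linearMapAt ℝ x₀), ← hb]
    exact b.linearIndependent.map' _ <| LinearMap.ker_eq_bot.mpr <|
      LeftInverse.injective (τ.symmₗ_linearMapAt (R := ℝ) hτ.self_of_nhds)
  obtain ⟨c, hc₀, hc⟩ := exists_eventually_hasAngleBound_span hlim hli (range Sum.inlₗ)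
  obtain ⟨a, ha₀, ha⟩ :=
    eventually_norm_trivializationAt_lt V (fun y : M => TangentSpace I y) x₀
  obtain ⟨b, hb₀, hb⟩ :=
    eventually_norm_symmL_trivializationAt_lt V (fun y : M => TangentSpace I y) x₀
  refine ⟨b * c * a, by positivity, ?_⟩
  rw [← nhdsWithin_inter_of_mem (nhdsWithin_le_nhds hU : U ∈ 𝓝[Γ] x₀)]
  filter_upwards [hc, nhdsWithin_le_nhds ha, nhdsWithin_le_nhds hb, nhdsWithin_le_nhds hτ,
    self_mem_nhdsWithin] with x hcx hax hbx hτx hxU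
  refine HasAngleBound.of_map (T := τ.linearMapAt ℝ x) ?_ hc₀ hb₀.le
    ((τ.continuousLinearMapAt ℝ x).le_of_opNorm_le hax.le) fun w => ?_
  · obtain ⟨β, hβ, hβE, hβF⟩ := hframe x hxU
    rwa [← hβE, ← hβF, Submodule.map_span, Submodule.map_span, image_image, image_image, hβ]
  · have hw := (τ.symmL ℝ x).le_of_opNorm_le hbx.le (τ.continuousLinearMapAt ℝ x w)
    rwa [τ.symmL_continuousLinearMapAt hτx] at hw

theorem exists_forall_hasAngleBound (hΓ : IsCompact Γ)
    (hE : IsContSubbundle (IsContVectorField I) Γ E)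
    (hF : IsContSubbundle (IsContVectorField I) Γ F) (hEF : ∀ x ∈ Γ, IsCompl (E x) (F x)) :
    ∃ c, 0 ≤ c ∧ ∀ x ∈ Γ, HasAngleBound c (E x) (F x) := by
  refine hΓ.induction_on (p := fun s => ∃ c, 0 ≤ c ∧ ∀ x ∈ s, HasAngleBound c (E x) (F x))
    ⟨0, le_rfl, by simp⟩ ?_ ?_ fun x₀ hx₀ => ?_
  · rintro s t hst ⟨c, hc₀, hc⟩
    exact ⟨c, hc₀, fun x hx => hc x (hst hx)⟩
  · rintro s t ⟨c, hc₀, hc⟩ ⟨c', -, hc'⟩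
    exact ⟨max c c', le_max_of_le_left hc₀, fun x hx => hx.elim
      (fun hxs => (hc x hxs).mono (le_max_left _ _))
      fun hxt => (hc' x hxt).mono (le_max_right _ _)⟩
  · obtain ⟨c, hc₀, hc⟩ := exists_hasAngleBound_nhdsWithin hE hF hEF hx₀
    exact ⟨_, hc, c, hc₀, fun x hx => hx⟩

end Angle

end Subbundle

section RiemannianBundle

variable {EB HB B F : Type*} [NormedAddCommGroup EB] [NormedSpace ℝ EB] [TopologicalSpace HB]
  {IB : ModelWithCorners ℝ EB HB} {n : ℕ∞ω} [TopologicalSpace B] [ChartedSpace HB B]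
  [NormedAddCommGroup F] [NormedSpace ℝ F] {E : B → Type*} [TopologicalSpace (TotalSpace F E)]
  [∀ x, NormedAddCommGroup (E x)] [∀ x, InnerProductSpace ℝ (E x)] [FiberBundle F E]
  [VectorBundle ℝ F E]

theorem isContinuousRiemannianBundle_of_isContMDiff (h : IsContMDiffRiemannianBundle IB n F E) :
    IsContinuousRiemannianBundle F E := by
  obtain ⟨g, hg, hinner⟩ := h.exists_contMDiff
  exact ⟨g, hg.continuous, hinner⟩

end RiemannianBundle

section Flow

variable {V : Type*} [NormedAddCommGroup V] [NormedSpace ℝ V]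
  {H : Type*} [TopologicalSpace H] {I : ModelWithCorners ℝ V H}
  {M : Type*} [TopologicalSpace M] [ChartedSpace H M]
  {φ : ℝ → M → M} {t : ℝ} {x : M}

theorem mdifferentiableAt_of_map_derivCocycle_ne_bot {F : Submodule ℝ (TangentSpace I x)}
    (h : F.map (derivCocycle I φ t x) ≠ ⊥) : MDifferentiableAt I I (φ t) x := by
  contrapose! h
  rw [derivCocycle, mfderiv_zero_of_not_mdifferentiableAt h]
  exact Submodule.map_zero F

theorem norm_mfderiv_of_eq_id [RiemannianBundle (fun x : M => TangentSpace I x)] {f : M → M}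
    (hf : f = id) (x : M) (v : TangentSpace I x) : ‖mfderiv I I f x v‖ = ‖v‖ := by
  subst hf
  rw [mfderiv_id]
  rfl

theorem norm_derivCocycle_zero [RiemannianBundle (fun x : M => TangentSpace I x)]
    (hφ : ∀ y, φ 0 y = y) (v : TangentSpace I x) : ‖derivCocycle I φ 0 x v‖ = ‖v‖ :=
  norm_mfderiv_of_eq_id (funext hφ) x v

theorem norm_derivCocycle_neg [RiemannianBundle (fun x : M => TangentSpace I x)]
    (hφ : ∀ y, φ (-t) (φ t y) = y) (ht : MDifferentiableAt I I (φ t) x)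
    (hneg : MDifferentiableAt I I (φ (-t)) (φ t x)) (v : TangentSpace I x) :
    ‖derivCocycle I φ (-t) (φ t x) (derivCocycle I φ t x v)‖ = ‖v‖ := by
  have hid := norm_mfderiv_of_eq_id (I := I) (f := φ (-t) ∘ φ t) (funext hφ) x v
  rwa [mfderiv_comp x hneg ht] at hid

end Flow

theorem lemma3_general
    {V : Type*} [NormedAddCommGroup V] [NormedSpace ℝ V] [FiniteDimensional ℝ V]
    {H : Type*} [TopologicalSpace H] (I : ModelWithCorners ℝ V H)
    {M : Type*} [TopologicalSpace M] [ChartedSpace H M] [IsManifold I 1 M]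
    [RiemannianBundle (fun x : M => TangentSpace I x)]
    [IsContinuousRiemannianBundle V (fun x : M => TangentSpace I x)]
    (φ : ℝ → M → M) (hφ₀ : ∀ x, φ 0 x = x) (hφ : ∀ t, 0 ≤ t → ∀ x, φ (-t) (φ t x) = x)
    (Γ : Set M) (hΓ : IsCompact Γ) (hΓφ : ∀ t, MapsTo (φ t) Γ Γ)
    (k : ℕ) (hk : 1 ≤ k)
    (E F : ∀ x : M, Submodule ℝ (TangentSpace I x))
    (hEF : IsInvariantSplitting (IsContVectorField I) φ (derivCocycle I φ) Γ E F)
    (hF : ∀ x ∈ Γ, finrank ℝ (F x) = k) :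
    (VolumeExpanding φ (derivCocycle I φ) Γ F ↔
      UniformlyExpanded φ (wedgeCocycle I k φ) Γ (fun x => wedgeSub k (F x))) ∧
    (UniformlyContracted φ (derivCocycle I φ) Γ E →
      (IsSingularHyperbolic (IsContVectorField I) φ (derivCocycle I φ) Γ E F ↔
        IsPartiallyHyperbolic (IsContMultivectorField I k) φ (wedgeCocycle I k φ) Γ
            (fun x => mixedSub k (E x) (F x)) (fun x => wedgeSub k (F x)) ∧
          UniformlyExpanded φ (wedgeCocycle I k φ) Γ (fun x => wedgeSub k (F x)))) := by
  have hk₀ : k ≠ 0 := Nat.one_le_iff_ne_zero.mp hk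
  have hdiff : ∀ x ∈ Γ, ∀ t, MDifferentiableAt I I (φ t) x := fun x hx t =>
    mdifferentiableAt_of_map_derivCocycle_ne_bot (F := F x) <| by
      rw [hEF.map_right x hx t, Ne, ← finrank_eq_zero (R := ℝ), hF _ (hΓφ t hx)]
      exact hk₀
  have hneg : ∀ x ∈ Γ, ∀ t, 0 ≤ t → ∀ v ∈ F x,
      ‖derivCocycle I φ (-t) (φ t x) (derivCocycle I φ t x v)‖ = ‖v‖ := fun x hx t ht v _ =>
    norm_derivCocycle_neg (hφ t ht) (hdiff x hx t) (hdiff _ (hΓφ t hx) _) v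
  have hvol : VolumeExpanding φ (derivCocycle I φ) Γ F ↔
      UniformlyExpanded φ (wedgeCocycle I k φ) Γ fun x => wedgeSub k (F x) :=
    volumeExpanding_iff_uniformlyExpanded_wedge hF hEF.map_right
      (fun _ _ v _ => norm_derivCocycle_zero hφ₀ v) hneg
  obtain ⟨c, hc₀, hc⟩ :=
    exists_forall_hasAngleBound hΓ hEF.continuous_left hEF.continuous_right hEF.isCompl
  refine ⟨hvol, fun hcontr => ⟨fun ⟨hdom, _, hexp⟩ => ?_, fun ⟨⟨hdom, _⟩, hexp⟩ => ?_⟩⟩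
  · exact ⟨⟨hdom.wedge (n := finrank ℝ V) (hEF.wedge k) (fun _ _ => rfl) hk₀ hF hc₀ hc hneg,
      .inr (hvol.mp hexp)⟩, hvol.mp hexp⟩
  · exact ⟨hdom.of_wedge hEF hk₀ hF hΓφ hc₀ hc hneg, hcontr, hvol.mpr hexp⟩

theorem lemma3
    {V : Type*} [NormedAddCommGroup V] [NormedSpace ℝ V] [FiniteDimensional ℝ V]
    {H : Type*} [TopologicalSpace H] (I : ModelWithCorners ℝ V H)
    {M : Type*} [TopologicalSpace M] [ChartedSpace H M] [IsManifold I ∞ M]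
    [RiemannianBundle (fun x : M => TangentSpace I x)]
    [IsContMDiffRiemannianBundle I ∞ V (fun x : M => TangentSpace I x)]
    (X : ∀ x : M, TangentSpace I x)
    (hX : ContMDiff I I.tangent 1 (fun x => (⟨x, X x⟩ : TangentBundle I M)))
    (φ : ℝ → M → M) (hφ : IsFlowOf I X φ)
    (Γ : Set M) (hΓ : IsCompact Γ) (hΓφ : ∀ t : ℝ, φ t '' Γ = Γ)
    (k : ℕ) (hk : 1 ≤ k)
    (E F : ∀ x : M, Submodule ℝ (TangentSpace I x))
    (hEF : IsInvariantSplitting (IsContVectorField I) φ (derivCocycle I φ) Γ E F)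
    (hF : ∀ x ∈ Γ, Module.finrank ℝ (F x) = k) :
    (VolumeExpanding φ (derivCocycle I φ) Γ F ↔
      UniformlyExpanded φ (wedgeCocycle I k φ) Γ (fun x => wedgeSub k (F x))) ∧
    (UniformlyContracted φ (derivCocycle I φ) Γ E →
      (IsSingularHyperbolic (IsContVectorField I) φ (derivCocycle I φ) Γ E F ↔
        IsPartiallyHyperbolic (IsContMultivectorField I k) φ (wedgeCocycle I k φ) Γ
            (fun x => mixedSub k (E x) (F x)) (fun x => wedgeSub k (F x)) ∧
          UniformlyExpanded φ (wedgeCocycle I k φ) Γ (fun x => wedgeSub k (F x)))) := by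
  have := isContinuousRiemannianBundle_of_isContMDiff ‹IsContMDiffRiemannianBundle I ∞ V _›
  exact lemma3_general I φ hφ.zero hφ.neg_apply Γ hΓ
    (fun t => mapsTo_iff_image_subset.mpr (hΓφ t).subset) k hk E F hEF hF
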